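/- Let $F$ be a number field with class number $h_F$, discriminant $D_F$ and different $\mathfrak d_F$, let $p$ be an odd prime not dividing $D_F h_F$, let $\mathfrak p$ be a prime ideal of $F$ above $p$, and let $\mathrm f(F,\mathfrak p)$ be its residue degree. Let $\mathfrak N$ be a nonzero integral ideal such that $\mathfrak p$ is coprime to $\mathfrak d_F\mathfrak N$. Let $(\mathbf k,\mathbf m)=\big((k_\sigma),(m_\sigma)\big)$ be a family of pairs of integers indexed by the embeddings $\sigma:F\to\mathbb C$, with $k_\sigma\ge 2$, $k_{\bar\sigma}=k_\sigma$, and $k_\sigma+2m_\sigma=k$ independent of $\sigma$; put $n_\sigma=k_\sigma-2$. Let $\chi$ be a Hecke character of $F$ of modulus $\mathfrak N$ with $\chi_\infty(z)=\prod_\sigma \sigma(z)^{-(n_\sigma+2m_\sigma)}$ on $F_\infty^\times$. Fix a uniformizer $\varpi_v$ of $F_v$ for each finite place $v$, put $\varpi_{\mathfrak m}=\prod_{v\mid\mathfrak m}\varpi_v^{\mathrm{ord}_v(\mathfrak m)}$ (a finite idele with components $1$ away from $\mathfrak m$), and fix a finite idele $d_F$ generating $\mathfrak d_F$. Let $\mathbf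 e_F$ be the additive character of $\mathbb A_F/F$ with $\mathbf e_F(z_\infty)=\prod_{w\mid\infty}\exp(2\pi i\,\mathrm{Tr}_{F_w/\mathbb R}z_w)$. For a Hecke character $\varphi$ of $F$ of finite order with conductor $\mathfrak c$, let $(\mathfrak c^{-1}/\mathcal O_F)^\times$ be the set of classes in $\mathfrak c^{-1}/\mathcal O_F$ with annihilator exactly $\mathfrak c$, and put $$G(\varphi)=\varphi(d_F)^{-1}\sum_{u\in(\mathfrak c^{-1}/\mathcal O_F)^\times}\varphi(\varpi_{\mathfrak c}u)\,\mathbf e_F(d_F^{-1}u),\qquad W(\varphi)=N(\mathfrak c)^{1-k}\,\chi(\varpi_{\mathfrak c})\,\overline{\chi_{\mathfrak N}(\varpi_{\mathfrak c})}\,\varphi(-\varpi_{\mathfrak c}^2)\,G(\overline\varphi)^2,$$ where $u$ is regarded as an element of $\prod_{v\mid\mathfrak c}F_v$ and $\chi_{\mathfrak N}(x)=\prod_{v\mid\mathfrak N}\chi(x_v)$. For a nonzero integral ideal $\mathfrak a$ let $\varphi(\mathfrak a)$ be $\varphi(\varpi_{\mathfrak a})$ if $\mathfrak a$ is coprime to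 $\mathfrak c$, and $0$ otherwise. For a finite extension $K/\mathbb Q$ inside $\mathbb C$, let $K(\varphi)$ be the field generated over $K$ by the values of $\varphi$, and put $$\varphi^\iota_{\mathrm{av}}(\mathfrak a)=\frac1{[K(\varphi):K]}\sum_{\sigma\in\mathrm{Gal}(K(\varphi)/K)}W(\varphi^\sigma)\,\overline{\varphi^\sigma(\mathfrak a)}.$$ Let $n_0$ be the largest integer $m\geq 0$ such that $K$ contains the $p^m$-th roots of unity, and, if $n_0=0$, let $n_1$ be the largest $m$ such that $K(\mu_p)$ contains the $p^m$-th roots of unity, where $\mu_p$ is the group of $p$-th roots of unity. Then there is a constant $C$ such that for every integer $n\ge 0$, every Hecke character $\psi_n$ of $F$ of $p$-power order and conductor $\mathfrak p^{n+n_0}$, and every nonzero integral ideal $\mathfrak a$ of $F$, $$|\psi^\iota_{n,\mathrm{av}}(\mathfrak a)|\le C\,N(\mathfrak p)^{n\left(\frac12-\frac1{\mathrm f(F,\mathfrak p)}\right)}.$$ The constant $C$ depends only on $F$, $\mathfrak p$ and $n_0$ if $n_0\ge1$, and only on $F$, $\mathfrak p$ and $n_1$ if $n_0=0$. In particular it does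 not depend on $(\mathbf k,\mathbf m)$, $\mathfrak N$, $\chi$, $n$, $\psi_n$, $\mathfrak a$ or the choices of $\varpi_v$ and $d_F$. -/

import Mathlib

open NumberField IsDedekindDomain

noncomputable section

namespace HeckeAverage

variable (F : Type*) [Field F] [NumberField F]

/-- The idele group of `F`. -/
abbrev Idele := (AdeleRing (𝓞 F) F)ˣ

/-- The group of finite ideles of `F`. -/
abbrev FiniteIdele := (FiniteAdeleRing (𝓞 F) F)ˣ

variable {F}

/-- A finite idele as an idele, with component `1` at every infinite place. -/
def finiteToIdele : FiniteIdele F →* Idele F where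
  toFun x :=
    { val := ((1 : InfiniteAdeleRing F), (x : FiniteAdeleRing (𝓞 F) F))
      inv := ((1 : InfiniteAdeleRing F), ((x⁻¹ : FiniteIdele F) : FiniteAdeleRing (𝓞 F) F))
      val_inv := Prod.ext (mul_one _) x.mul_inv
      inv_val := Prod.ext (mul_one _) x.inv_mul }
  map_one' := rfl
  map_mul' _ _ := Units.ext (Prod.ext (mul_one _).symm rfl)

/-- An element of `F_∞ˣ` as an idele, with component `1` at every finite place. -/
def infiniteToIdele : (InfiniteAdeleRing F)ˣ →* Idele F where
  toFun z :=
    { val := ((z : InfiniteAdeleRing F), (1 : FiniteAdeleRing (𝓞 F) F))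
      inv := (((z⁻¹ : (InfiniteAdeleRing F)ˣ) : InfiniteAdeleRing F),
        (1 : FiniteAdeleRing (𝓞 F) F))
      val_inv := Prod.ext z.mul_inv (mul_one _)
      inv_val := Prod.ext z.inv_mul (mul_one _) }
  map_one' := rfl
  map_mul' _ _ := Units.ext (Prod.ext rfl (mul_one _).symm)

open Classical in
/-- The element of `F_vˣ` given by a nonzero `x ∈ F_v` (and `1` for `x = 0`). -/
def toUnit {v : HeightOneSpectrum (𝓞 F)} (x : v.adicCompletion F) : (v.adicCompletion F)ˣ :=
  if h : x = 0 then 1 else Units.mk0 x h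

open Classical in
/-- The embedding of `F_vˣ` in the finite ideles, with component `1` away from `v`. -/
def localIdele (v : HeightOneSpectrum (𝓞 F)) : (v.adicCompletion F)ˣ →* FiniteIdele F :=
  Units.map
    { toFun := fun x => RestrictedProduct.mulSingle
        (G := fun w : HeightOneSpectrum (𝓞 F) => w.adicCompletion F)
        (S := fun w : HeightOneSpectrum (𝓞 F) => ValuationSubring (w.adicCompletion F))
        (fun w : HeightOneSpectrum (𝓞 F) => w.adicCompletionIntegers F) v x
      map_one' := RestrictedProduct.mulSingle_one _ v
      map_mul' := fun x y => RestrictedProduct.mulSingle_mul _ v x y }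

/-- `φ` is a Hecke character: a continuous character of the ideles, trivial on `Fˣ`. -/
def IsHeckeCharacter (φ : Idele F →* ℂˣ) : Prop :=
  Continuous φ ∧ ∀ x : Fˣ, φ (Units.map (algebraMap F (AdeleRing (𝓞 F) F)).toMonoidHom x) = 1

/-- The exponent of the prime `v` in the ideal `𝔪` (for `𝔪 ≠ 0`). -/
def ord (v : HeightOneSpectrum (𝓞 F)) (𝔪 : Ideal (𝓞 F)) : ℕ := multiplicity v.asIdeal 𝔪

/-- The finite ideles `x` with `x_v` a unit and `x_v ≡ 1 mod 𝔪` for all finite `v`. -/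
def congruenceUnits (𝔪 : Ideal (𝓞 F)) : Set (FiniteIdele F) :=
  {x | ∀ v : HeightOneSpectrum (𝓞 F),
    Valued.v ((x : FiniteAdeleRing (𝓞 F) F) v) = 1 ∧
    Valued.v ((x : FiniteAdeleRing (𝓞 F) F) v - 1) ≤ WithZero.exp (-(ord v 𝔪 : ℤ))}

/-- The moduli of `φ`: nonzero ideals `𝔪` such that `φ` is trivial on `congruenceUnits 𝔪`. -/
def moduli (φ : Idele F →* ℂˣ) : Set (Ideal (𝓞 F)) :=
  {𝔪 | 𝔪 ≠ ⊥ ∧ ∀ x ∈ congruenceUnits 𝔪, φ (finiteToIdele x) = 1}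

/-- The conductor of `φ`: the largest modulus (the sum, i.e. the gcd, of all moduli). -/
def conductor (φ : Idele F →* ℂˣ) : Ideal (𝓞 F) := sSup (moduli φ)

/-- `𝔠` is the conductor of `φ`, i.e. its largest modulus. -/
def HasConductor (φ : Idele F →* ℂˣ) (𝔠 : Ideal (𝓞 F)) : Prop := IsGreatest (moduli φ) 𝔠

/-- `ϖ` is a choice of a uniformizer of `F_v` for every finite place `v`. -/
def IsUniformizers (ϖ : ∀ v : HeightOneSpectrum (𝓞 F), (v.adicCompletion F)ˣ) : Prop :=
  ∀ v, Valued.v (ϖ v : v.adicCompletion F) = WithZero.exp (-1 : ℤ)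

/-- The finite idele `x` generates the ideal `𝔪`. -/
def IsIdeleOf (x : FiniteIdele F) (𝔪 : Ideal (𝓞 F)) : Prop :=
  ∀ v, Valued.v ((x : FiniteAdeleRing (𝓞 F) F) v) = WithZero.exp (-(ord v 𝔪 : ℤ))

/-- The finite idele `ϖ_𝔪 = ∏_{v ∣ 𝔪} ϖ_v ^ ord_v(𝔪)`; its components away from `𝔪` are `1`. -/
def uniformizerIdele (ϖ : ∀ v : HeightOneSpectrum (𝓞 F), (v.adicCompletion F)ˣ)
    (𝔪 : Ideal (𝓞 F)) : FiniteIdele F :=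
  ∏ᶠ v, localIdele v (ϖ v) ^ ord v 𝔪

open Classical in
/-- The value `φ(𝔞)` at an integral ideal: `∏_v φ(ϖ_v) ^ ord_v(𝔞)` if `𝔞` is nonzero and prime to
the conductor, and `0` otherwise. -/
def idealValue (ϖ : ∀ v : HeightOneSpectrum (𝓞 F), (v.adicCompletion F)ˣ)
    (φ : Idele F →* ℂˣ) (𝔞 : Ideal (𝓞 F)) : ℂ :=
  if 𝔞 ≠ ⊥ ∧ IsCoprime 𝔞 (conductor φ) then
    (φ (finiteToIdele (uniformizerIdele ϖ 𝔞)) : ℂ) else 0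

open Classical in
/-- The standard additive character `𝐞_F` of `𝔸_F / F`, the one with
`𝐞_F(z_∞) = ∏_w exp(2πi Tr_{F_w/ℝ} z_w)` on `F_∞`: if `ξ ∈ F` is such that the finite part of `z - ξ`
is everywhere integral (such `ξ` exists by strong approximation), then
`𝐞_F(z) = 𝐞_F(z - ξ) = 𝐞_F(z_∞ - ξ) = exp(2πi (Tr z_∞ - Tr_{F/ℚ} ξ))`. -/
def addChar (z : AdeleRing (𝓞 F) F) : ℂ :=
  if h : ∃ ξ : F, ∀ v : HeightOneSpectrum (𝓞 F), Valued.v (z.2 v - (ξ : v.adicCompletion F)) ≤ 1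
  then Complex.exp (2 * Real.pi * Complex.I *
    ((∑ w : InfinitePlace F,
        ((w.mult : ℝ) * (InfinitePlace.Completion.extensionEmbedding w (z.1 w)).re : ℝ) : ℂ) -
      ((Algebra.trace ℚ F h.choose : ℚ) : ℂ)))
  else 1

/-- The finite idele with component `u` at every `v ∣ 𝔠` and `1` elsewhere. -/
def ideleAt (𝔠 : Ideal (𝓞 F)) (u : F) : FiniteIdele F :=
  ∏ᶠ (v : HeightOneSpectrum (𝓞 F)) (_ : v.asIdeal ∣ 𝔠),
    localIdele v (toUnit (u : v.adicCompletion F))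

open Classical in
/-- The finite adele with component `u` at every `v ∣ 𝔠` and `0` elsewhere, that is, the image of
`u` in `∏_{v ∣ 𝔠} F_v`. -/
def adeleAt (𝔠 : Ideal (𝓞 F)) (u : F) : FiniteAdeleRing (𝓞 F) F :=
  ⟨fun v => if v.asIdeal ∣ 𝔠 then (u : v.adicCompletion F) else 0, by
    refine (algebraMap F (FiniteAdeleRing (𝓞 F) F) u).2.mono fun v hv => ?_
    dsimp only
    split_ifs
    · exact hv
    · exact zero_mem _⟩

/-- The classes in `F / 𝓞_F` with annihilator exactly `𝔠`; this is `(𝔠⁻¹ / 𝓞_F)ˣ`. -/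
def primitiveClasses (𝔠 : Ideal (𝓞 F)) : Set (F ⧸ (1 : Submodule (𝓞 F) F)) :=
  {q | Ideal.torsionOf (𝓞 F) _ q = 𝔠}

/-- The Gauss sum
`G(φ) = φ(d_F)⁻¹ ∑_{u ∈ (𝔠⁻¹/𝓞_F)ˣ} φ(ϖ_𝔠 u) 𝐞_F(d_F⁻¹ u)`, where `𝔠` is the conductor of `φ`
and `u` is placed at the primes dividing `𝔠`. -/
def gaussSum (ϖ : ∀ v : HeightOneSpectrum (𝓞 F), (v.adicCompletion F)ˣ) (d : FiniteIdele F)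
    (φ : Idele F →* ℂˣ) : ℂ :=
  (φ (finiteToIdele d) : ℂ)⁻¹ *
    ∑ᶠ q ∈ primitiveClasses (conductor φ),
      (φ (finiteToIdele (uniformizerIdele ϖ (conductor φ) *
          ideleAt (conductor φ) (Quotient.out q))) : ℂ) *
        addChar ((0 : InfiniteAdeleRing F),
          ((d⁻¹ : FiniteIdele F) : FiniteAdeleRing (𝓞 F) F) *
            adeleAt (conductor φ) (Quotient.out q))

/-- The complex conjugate of a character. -/
def conjChar (φ : Idele F →* ℂˣ) : Idele F →* ℂˣ :=
  (Units.map (starRingEnd ℂ).toMonoidHom).comp φ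

/-- `χ_𝔑` of a matrix with lower right entry `δ`: the product of `χ_v(δ_v)` over `v ∣ 𝔑`. -/
def levelChar (χ : Idele F →* ℂˣ) (𝔑 : Ideal (𝓞 F)) (δ : FiniteIdele F) : ℂˣ :=
  ∏ᶠ (v : HeightOneSpectrum (𝓞 F)) (_ : v.asIdeal ∣ 𝔑),
    χ (finiteToIdele (localIdele v (toUnit ((δ : FiniteAdeleRing (𝓞 F) F) v))))

/-- The root number factor
`W(φ) = N(𝔠)^{1-k} χ(ϖ_𝔠) conj(χ_𝔑(ϖ_𝔠)) φ(-ϖ_𝔠²) G(conj φ)²`, where `𝔠` is the conductor of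
`φ`. (The matrix at which `χ_𝔑` is taken has lower right entry `ϖ_𝔠`.) -/
def rootFactor (ϖ : ∀ v : HeightOneSpectrum (𝓞 F), (v.adicCompletion F)ˣ) (d : FiniteIdele F)
    (k : ℤ) (χ : Idele F →* ℂˣ) (𝔑 : Ideal (𝓞 F)) (φ : Idele F →* ℂˣ) : ℂ :=
  (Ideal.absNorm (conductor φ) : ℂ) ^ (1 - k) *
    (χ (finiteToIdele (uniformizerIdele ϖ (conductor φ))) : ℂ) *
    starRingEnd ℂ (levelChar χ 𝔑 (uniformizerIdele ϖ (conductor φ)) : ℂ) *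
    (φ (finiteToIdele (-(uniformizerIdele ϖ (conductor φ)) ^ 2)) : ℂ) *
    gaussSum ϖ d (conjChar φ) ^ 2

/-- `K(φ)`: the field generated over `K` by the values of `φ`. -/
abbrev valueField (K : IntermediateField ℚ ℂ) (φ : Idele F →* ℂˣ) : IntermediateField K ℂ :=
  IntermediateField.adjoin K (Set.range fun x => (φ x : ℂ))

/-- The conjugate character `φ^σ = σ ∘ φ` for `σ ∈ Gal(K(φ)/K)`. -/
def galConj (K : IntermediateField ℚ ℂ) (φ : Idele F →* ℂˣ)
    (σ : valueField K φ ≃ₐ[K] valueField K φ) : Idele F →* ℂˣ :=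
  MonoidHom.toHomUnits
    { toFun := fun x => (σ ⟨(φ x : ℂ),
        IntermediateField.subset_adjoin K _ (Set.mem_range_self x)⟩ : ℂ)
      map_one' := by
        have h : (⟨(φ 1 : ℂ), IntermediateField.subset_adjoin K _ (Set.mem_range_self 1)⟩ :
            valueField K φ) = 1 := Subtype.ext (by simp)
        rw [h, map_one]; rfl
      map_mul' := fun x y => by
        have h : (⟨(φ (x * y) : ℂ),
            IntermediateField.subset_adjoin K _ (Set.mem_range_self (x * y))⟩ :
            valueField K φ) =
            ⟨(φ x : ℂ), IntermediateField.subset_adjoin K _ (Set.mem_range_self x)⟩ *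
            ⟨(φ y : ℂ), IntermediateField.subset_adjoin K _ (Set.mem_range_self y)⟩ :=
          Subtype.ext (by simp)
        rw [h, map_mul]; rfl }

/-- The root-number-twisted Galois average over `K`:
`φ^ι_av(𝔞) = [K(φ):K]⁻¹ ∑_{σ ∈ Gal(K(φ)/K)} W(φ^σ) conj(φ^σ(𝔞))`. -/
def twistedAverage (ϖ : ∀ v : HeightOneSpectrum (𝓞 F), (v.adicCompletion F)ˣ)
    (d : FiniteIdele F) (k : ℤ) (χ : Idele F →* ℂˣ) (𝔑 : Ideal (𝓞 F))
    (K : IntermediateField ℚ ℂ) (φ : Idele F →* ℂˣ) (𝔞 : Ideal (𝓞 F)) : ℂ :=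
  (Module.finrank K (valueField K φ) : ℂ)⁻¹ *
    ∑ᶠ σ : valueField K φ ≃ₐ[K] valueField K φ,
      rootFactor ϖ d k χ 𝔑 (galConj K φ σ) *
        starRingEnd ℂ (idealValue ϖ (galConj K φ σ) 𝔞)

variable (F) in
/-- A cohomological weight `(𝐤, 𝐦)`, indexed by the embeddings of `F` in `ℂ`. The integer
`central` is the common value `k` of `k_σ + 2 m_σ`. -/
structure CohomologicalWeight where
  k : (F →+* ℂ) → ℤ
  m : (F →+* ℂ) → ℤ
  central : ℤ
  two_le : ∀ σ, 2 ≤ k σ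
  add_two_mul : ∀ σ, k σ + 2 * m σ = central
  conj_eq : ∀ σ, k (ComplexEmbedding.conjugate σ) = k σ

open Classical in
/-- The extension `z ↦ z^σ` of an embedding `σ : F → ℂ` to `F_∞`. -/
def embedInfinite (σ : F →+* ℂ) (z : InfiniteAdeleRing F) : ℂ :=
  if (InfinitePlace.mk σ).embedding = σ then
    InfinitePlace.Completion.extensionEmbedding (InfinitePlace.mk σ) (z (InfinitePlace.mk σ))
  else
    starRingEnd ℂ
      (InfinitePlace.Completion.extensionEmbedding (InfinitePlace.mk σ) (z (InfinitePlace.mk σ)))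

/-- `χ` is an admissible central character of weight `(𝐤, 𝐦)` and level `𝔑`: a Hecke character of
modulus `𝔑` with `χ_∞(z) = z^{-(𝐧 + 2𝐦)}`, where `n_σ = k_σ - 2`. -/
def IsCentralCharacter (wt : CohomologicalWeight F) (𝔑 : Ideal (𝓞 F)) (χ : Idele F →* ℂˣ) :
    Prop :=
  IsHeckeCharacter χ ∧ 𝔑 ∈ moduli χ ∧
    ∀ z : (InfiniteAdeleRing F)ˣ, (χ (infiniteToIdele z) : ℂ) =
      ∏ σ : F →+* ℂ, embedInfinite σ (z : InfiniteAdeleRing F) ^ (-((wt.k σ - 2) + 2 * wt.m σ))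

end HeckeAverage

end

/-! Write `𝔭 ^ N` for the conductor and `q` for the norm of `𝔭`. Expanding the two Gauss sums turns
`W(φ^σ)` times the conjugate of `φ^σ(𝔞)` into a prefactor independent of `σ` times a double sum over
units `x, y` modulo `𝔭 ^ N` of a value of `φ^σ` times additive characters. Only the values of `φ^σ`
involve `σ`, so the average replaces them by normalized traces of `p`-power roots of unity. Such a
trace has absolute value at most `1` and vanishes outside `K(μ_p)`
(`sum_galois_eq_zero_of_notMem_adjoin`), so only roots of unity of order dividing `p ^ r` survive,
where `r` is `n₀`, or `n₁` if `n₀ = 0`.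

Let `θ` be the character of the units modulo `𝔭 ^ N` induced by `φ`. Grouping the pairs by `t = x *
y` leaves Kloosterman sums indexed by at most one coset of the kernel of `θ ^ p ^ r`. Three
estimates finish the proof. Each Kloosterman sum is at most `2 q^⌈N/2⌉`, by elementary stationary
phase (`norm_kloosterman_le_card`, `card_sq_sub_mem_le`). The coset has at most `p^(r+1-N) q^N`
elements: `p` is a uniformizer at `𝔭`, so for `N ≥ 2` every element of `1 + 𝔭^(N-1)` is a
`p^(N-2)`-th power modulo `𝔭^N`, and `θ` takes a value of order at least `p^(N-1)`
(`exists_orderOf_residueChar`). The prefactor has absolute value `q^(-N)` for every weight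
(`norm_rootFactor_prefactor`). The product is `2 p^(r+1) q^⌈N/2⌉ p^(-N)`, and `p = q^(1/f)` with `f`
the residue degree. -/

/-! ### Traces of roots of unity of `p`-power order. -/

/-- In a finite Galois extension `L / K`, a root of unity of order a power of the odd prime `p` has
trace zero unless it lies in `K(μ_p)`. -/
theorem sum_galois_eq_zero_of_notMem_adjoin {K L : Type*} [Field K] [Field L] [CharZero L]
    [Algebra K L] [FiniteDimensional K L] [IsGalois K L] {p : ℕ} (hp : p.Prime) (hodd : Odd p)
    {m : ℕ} {z : L} (hz : z ^ p ^ m = 1)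
    (hmem : z ∉ IntermediateField.adjoin K {x : L | x ^ p = 1}) :
    ∑ σ : L ≃ₐ[K] L, σ z = 0 := by
  classical
  have := Fact.mk hp
  obtain ⟨m, -, hm⟩ := (Nat.dvd_prime_pow hp).1 (orderOf_dvd_of_pow_eq_one hz)
  have hprim : IsPrimitiveRoot z (p ^ m) := hm ▸ IsPrimitiveRoot.orderOf z
  have hm0 : m ≠ 0 := by
    rintro rfl
    rw [pow_zero, orderOf_eq_one_iff] at hm
    exact hmem (by rw [hm]; exact one_mem _)
  obtain ⟨l, rfl⟩ := Nat.exists_eq_succ_of_ne_zero hm0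
  rw [Nat.succ_eq_add_one] at *
  set E := IntermediateField.adjoin K {x : L | x ^ p = 1} with hE
  -- an automorphism fixing `E` and moving `z`
  obtain ⟨σ, hσE, hσz⟩ : ∃ σ ∈ E.fixingSubgroup, σ z ≠ z := by
    by_contra! h
    apply hmem
    rw [← IsGalois.fixedField_fixingSubgroup E]
    exact fun g => h g.1 g.2
  have hfix : ∀ x : L, x ^ p = 1 → σ x = x := fun x hx =>
    (IntermediateField.mem_fixingSubgroup_iff E σ).1 hσE x
      (IntermediateField.subset_adjoin K _ hx)
  set ζ := z ^ p ^ l with hζ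
  have hζp : ζ ^ p = 1 := by rw [hζ, ← pow_mul, ← pow_succ, hprim.pow_eq_one]
  obtain ⟨s, hslt, hs⟩ := hprim.eq_pow_of_pow_eq_one (ξ := σ z)
    (by rw [← map_pow, hprim.pow_eq_one, map_one])
  -- `σ` raises `ζ` to the power `s` and also fixes it, as `ζ` lies in `E`.
  have hs1 : s ≡ 1 [MOD p] := by
    have h1 : ζ ^ s = ζ ^ 1 := by
      rw [pow_one, hζ, ← pow_mul, mul_comm, pow_mul, hs, ← map_pow]
      exact hfix _ hζp
    have hζprim : IsPrimitiveRoot ζ p :=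
      hprim.pow (pow_pos hp.pos _) (pow_succ p l)
    rw [← pow_mod_orderOf ζ s, ← pow_mod_orderOf ζ 1, ← hζprim.eq_orderOf] at h1
    exact hζprim.pow_inj (Nat.mod_lt _ hp.pos) (Nat.mod_lt _ hp.pos) h1
  have hps : ¬ p ∣ s := fun h => by
    have := (Nat.modEq_zero_iff_dvd.2 h).symm.trans hs1
    rw [Nat.ModEq, Nat.zero_mod, Nat.mod_eq_of_lt hp.one_lt] at this
    exact zero_ne_one this
  have hs_gt : 1 < s := by
    rcases Nat.lt_or_ge 1 s with h | h
    · exact h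
    · interval_cases s
      · exact absurd (dvd_zero p) hps
      · exact absurd (by simpa using hs.symm) hσz
  have hdvd : p ∣ s - 1 := (Nat.modEq_iff_dvd' hs_gt.le).1 hs1.symm
  set v := padicValNat p (s - 1) with hv
  have hvl : v ≤ l := by
    by_contra! h
    have h1 : p ^ (l + 1) ∣ s - 1 := (pow_dvd_pow p h).trans pow_padicValNat_dvd
    have := Nat.le_of_dvd (by omega) h1
    omega
  -- a power of `σ` multiplies `z` by a `p`-th root of unity
  have hval : padicValNat p (s ^ p ^ (l - v) - 1) = l := by
    have := padicValNat.pow_sub_pow hodd hs_gt hdvd hps (n := p ^ (l - v))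
      (pow_ne_zero _ hp.ne_zero)
    rw [one_pow, padicValNat.prime_pow] at this
    rw [this]; omega
  have hpow : ∀ i : ℕ, (σ ^ i) z = z ^ s ^ i := by
    intro i
    induction i with
    | zero => simp
    | succ i ih => rw [pow_succ', AlgEquiv.mul_apply, ih, map_pow, ← hs, ← pow_mul, pow_succ']
  set τ := σ ^ p ^ (l - v) with hτ
  have hgt1 : 1 < s ^ p ^ (l - v) := Nat.one_lt_pow (pow_ne_zero _ hp.ne_zero) hs_gt
  have hle : 1 ≤ s ^ p ^ (l - v) := hgt1.le
  obtain ⟨c, hc⟩ : p ^ l ∣ s ^ p ^ (l - v) - 1 := by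
    conv_lhs => rw [← hval]
    exact pow_padicValNat_dvd
  set η := ζ ^ c with hη
  have hηp : η ^ p = 1 := by rw [hη, pow_right_comm, hζp, one_pow]
  have hη1 : η ≠ 1 := by
    intro h
    rw [hη, hζ, ← pow_mul, ← hc] at h
    have h2 := hprim.dvd_of_pow_eq_one _ h
    rw [padicValNat_dvd_iff_le (by omega), hval] at h2
    omega
  have hτz : τ z = z * η := by
    rw [hτ, hpow, hη, hζ, ← pow_mul, ← hc, ← pow_succ', Nat.sub_add_cancel hle]
  have hση : ∀ i : ℕ, (σ ^ i) η = η := by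
    intro i
    induction i with
    | zero => simp
    | succ i ih => rw [pow_succ', AlgEquiv.mul_apply, ih, hfix η hηp]
  have hτi : ∀ i : ℕ, (τ ^ i) z = z * η ^ i := by
    intro i
    induction i with
    | zero => simp
    | succ i ih =>
      rw [pow_succ', AlgEquiv.mul_apply, ih, map_mul, hτz, map_pow, hτ, hση, pow_succ' η, mul_assoc]
  -- Right translation by `τ ^ i` preserves the trace and inserts the factor `(g η) ^ i`. Summing
  -- over `i < p` gives `p` times the trace on one side and vanishing geometric sums on the other.
  have key : ∀ i ∈ Finset.range p, ∑ g : L ≃ₐ[K] L, g z = ∑ g : L ≃ₐ[K] L, g z * (g η) ^ i := by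
    intro i _
    rw [← Equiv.sum_comp (Equiv.mulRight (τ ^ i))]
    refine Finset.sum_congr rfl fun g _ => ?_
    rw [Equiv.coe_mulRight, AlgEquiv.mul_apply, hτi, map_mul, map_pow]
  have hsum := Finset.sum_congr rfl key
  rw [Finset.sum_const, Finset.card_range, Finset.sum_comm, nsmul_eq_mul] at hsum
  have hzero : ∀ g : L ≃ₐ[K] L, ∑ i ∈ Finset.range p, g z * (g η) ^ i = 0 := by
    intro g
    rw [← Finset.mul_sum]
    have h1 : g η - 1 ≠ 0 := by
      rw [sub_ne_zero, ← map_one g]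
      exact fun h => hη1 (g.injective h)
    have h2 := mul_geom_sum (g η) p
    rw [← map_pow, hηp, map_one, sub_self] at h2
    rw [(mul_eq_zero.1 h2).resolve_left h1, mul_zero]
  rw [Finset.sum_eq_zero fun g _ => hzero g] at hsum
  exact (mul_eq_zero.1 hsum).resolve_left (Nat.cast_ne_zero.2 hp.ne_zero)

/-! ### Averages of Kloosterman sums over a finite local ring. -/

/-- The image of `θ ^ p ^ r` contains an element of order at least `p ^ (m - r)`, which bounds the
index of its kernel from below. The multiplicative form also covers `r > m`. -/
theorem card_ker_pow_mul_le {G : Type*} [CommGroup G] [Finite G] {p : ℕ} (hp : p.Prime)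
    (θ : G →* ℂˣ) {g : G} {m : ℕ} (r : ℕ) (hg : orderOf (θ g) = p ^ m) :
    Nat.card {t : G // θ t ^ p ^ r = 1} * p ^ m ≤ p ^ r * Nat.card G := by
  set f : G →* ℂˣ := (powMonoidHom (p ^ r)).comp θ with hf
  have h1 : Nat.card f.ker * Nat.card f.range = Nat.card G := by
    rw [← Subgroup.index_ker, Subgroup.card_mul_index]
  have h2 : Nat.card {t : G // θ t ^ p ^ r = 1} = Nat.card f.ker :=
    Nat.card_congr (Equiv.subtypeEquivRight fun t => by simp [hf, MonoidHom.mem_ker])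
  have h3 : orderOf (θ g ^ p ^ r) ≤ Nat.card f.range := by
    rw [← Nat.card_zpowers]
    have : Finite f.range := Set.finite_range f
    have hle : Subgroup.zpowers (θ g ^ p ^ r) ≤ f.range := Subgroup.zpowers_le.2 ⟨g, rfl⟩
    exact Nat.card_le_card_of_injective (Subgroup.inclusion hle) (Subgroup.inclusion_injective _)
  have h4 : p ^ m ≤ p ^ r * orderOf (θ g ^ p ^ r) := by
    rw [orderOf_pow' _ (pow_ne_zero _ hp.ne_zero), hg]
    calc p ^ m = (p ^ m).gcd (p ^ r) * (p ^ m / (p ^ m).gcd (p ^ r)) :=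
          (Nat.mul_div_cancel' (Nat.gcd_dvd_left _ _)).symm
      _ ≤ _ := Nat.mul_le_mul_right _ (Nat.gcd_le_right _ (pow_pos hp.pos _))
  calc _ ≤ Nat.card f.ker * (p ^ r * Nat.card f.range) := by
        rw [h2]; exact Nat.mul_le_mul_left _ (h4.trans (Nat.mul_le_mul_left _ h3))
    _ = _ := by rw [← h1]; ring

/-- The elementary bound for Kloosterman sums over a ring with a square-zero ideal `J`. -/
theorem norm_kloosterman_le_card {R : Type*} [CommRing R] [Fintype R] [DecidableEq R]
    (Ψ : AddChar R ℂ) (J B : Ideal R) (hJ : ∀ x ∈ J, ∀ y ∈ J, x * y = 0)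
    (hB : ∀ w : R, (∀ z ∈ J, Ψ (w * z) = 1) → w ∈ B) (t : Rˣ) :
    ‖∑ x : Rˣ, Ψ (x : R) * Ψ ((t * x⁻¹ : Rˣ) : R)‖ ≤
      Nat.card {x : Rˣ // (x : R) ^ 2 - t ∈ B} := by
  classical
  -- Stationary phase: since `z ^ 2 = 0`, the substitution `x ↦ x * (1 + z)` sends `t / x` to `(t /
  -- x) * (1 - z)` and so multiplies the term at `x` by `Ψ ((x - t / x) * z)`.
  let u : J → Rˣ := fun z => ⟨1 + z, 1 - z, by linear_combination -hJ z z.2 z z.2,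
    by linear_combination -hJ z z.2 z z.2⟩
  set S := ∑ x : Rˣ, Ψ (x : R) * Ψ ((t * x⁻¹ : Rˣ) : R) with hS
  have hshift : ∀ z ∈ (Finset.univ : Finset J),
      S = ∑ x : Rˣ, Ψ (x : R) * Ψ ((t * x⁻¹ : Rˣ) : R) *
        Ψ ((x - (t * x⁻¹ : Rˣ) : R) * z) := by
    intro z _
    rw [hS, ← Equiv.sum_comp (Equiv.mulRight (u z))]
    refine Finset.sum_congr rfl fun x _ => ?_
    rw [← AddChar.map_add_eq_mul, ← AddChar.map_add_eq_mul, ← AddChar.map_add_eq_mul]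
    congr 1
    have h1 : ((u z : Rˣ) : R) = 1 + z := rfl
    have h2 : (((u z)⁻¹ : Rˣ) : R) = 1 - z := rfl
    simp only [Equiv.coe_mulRight, mul_inv_rev, Units.val_mul, h1, h2]
    ring
  have hsum := Finset.sum_congr rfl hshift
  rw [Finset.sum_const, Finset.card_univ, Finset.sum_comm, nsmul_eq_mul] at hsum
  -- By orthogonality on `J`, only those `x` survive for which `z ↦ Ψ ((x - t / x) * z)` is trivial
  -- on `J`; then `x - t / x`, and hence `x ^ 2 - t`, lies in `B`.
  have hinner : ∀ x : Rˣ, ‖∑ z : J, Ψ (x : R) * Ψ ((t * x⁻¹ : Rˣ) : R) *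
      Ψ ((x - (t * x⁻¹ : Rˣ) : R) * z)‖ ≤
      Fintype.card J * if (x : R) ^ 2 - t ∈ B then 1 else 0 := by
    intro x
    rw [← Finset.mul_sum, norm_mul, norm_mul, AddChar.norm_apply, AddChar.norm_apply, one_mul,
      one_mul]
    let χ : AddChar J ℂ :=
      Ψ.compAddMonoidHom ((AddMonoidHom.mulLeft (x - (t * x⁻¹ : Rˣ) : R)).comp
        J.toAddSubgroup.subtype)
    have hχ : ∀ z : J, χ z = Ψ ((x - (t * x⁻¹ : Rˣ) : R) * z) := fun z => rfl
    simp_rw [← hχ]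
    rw [AddChar.sum_eq_ite]
    split_ifs with h h' h'
    · simp
    · exfalso
      apply h'
      have h3 : (x - (t * x⁻¹ : Rˣ) : R) ∈ B := hB _ fun z hz => by
        have := hχ ⟨z, hz⟩
        rw [h, AddChar.zero_apply] at this
        exact this.symm
      have h4 := B.mul_mem_left (x : R) h3
      rwa [mul_sub, ← sq, ← Units.val_mul, mul_comm x, inv_mul_cancel_right] at h4
    · simp
    · simp
  have hcard : (0 : ℝ) < Fintype.card J := Nat.cast_pos.2 Fintype.card_pos
  have hfin : Fintype.card J * ‖S‖ ≤
      Fintype.card J * (Nat.card {x : Rˣ // (x : R) ^ 2 - t ∈ B} : ℝ) := by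
    calc Fintype.card J * ‖S‖ = ‖(Fintype.card J : ℂ) * S‖ := by simp
      _ ≤ ∑ x : Rˣ, Fintype.card J * (if (x : R) ^ 2 - t ∈ B then (1 : ℝ) else 0) := by
        rw [hsum]; exact norm_sum_le_of_le _ fun x _ => hinner x
      _ = _ := by
        rw [← Finset.mul_sum, Finset.sum_boole, ← Fintype.card_subtype,
          Nat.card_eq_fintype_card (α := {x : Rˣ // (x : R) ^ 2 - t ∈ B})]
  exact le_of_mul_le_mul_left hfin hcard

/-- For two solutions `x, y` the product `(x - y) * (x + y)` lies in `B`, while the sum `2 * x` of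
the two factors is a unit. In a local ring one factor is then a unit and the other lies in `B`, so
`x` is in `y + B` or in `-y + B`. -/
theorem card_sq_sub_mem_le {R : Type*} [CommRing R] [Finite R] [IsLocalRing R]
    (h2 : IsUnit (2 : R)) (B : Ideal R) (t : R) :
    Nat.card {x : Rˣ // (x : R) ^ 2 - t ∈ B} ≤ 2 * Nat.card B := by
  classical
  by_cases hne : Nonempty {x : Rˣ // (x : R) ^ 2 - t ∈ B}
  swap
  · rw [not_nonempty_iff] at hne
    simp
  obtain ⟨y, hy⟩ := hne
  have key : ∀ x : {x : Rˣ // (x : R) ^ 2 - t ∈ B},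
      ((x : Rˣ) : R) - y ∈ B ∨ ((x : Rˣ) : R) + y ∈ B := by
    intro x
    have hprod : (((x : Rˣ) : R) - y) * ((x : Rˣ) + y) ∈ B := by
      have := B.sub_mem x.2 hy
      ring_nf at this ⊢
      exact this
    have hsum : IsUnit ((((x : Rˣ) : R) - y) + ((x : Rˣ) + y)) := by
      have : (((x : Rˣ) : R) - y) + ((x : Rˣ) + y) = 2 * (x : Rˣ) := by ring
      rw [this]
      exact h2.mul (Units.isUnit _)
    rcases IsLocalRing.isUnit_or_isUnit_of_isUnit_add hsum with h | h
    · exact Or.inr ((B.unit_mul_mem_iff_mem h).1 hprod)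
    · exact Or.inl ((B.mul_unit_mem_iff_mem h).1 hprod)
  let f : {x : Rˣ // (x : R) ^ 2 - t ∈ B} → B ⊕ B := fun x =>
    if h : ((x : Rˣ) : R) - y ∈ B then Sum.inl ⟨_, h⟩ else Sum.inr ⟨_, (key x).resolve_left h⟩
  have hf : Function.Injective f := by
    intro x x' h
    simp only [f] at h
    split_ifs at h
    · simpa [Subtype.ext_iff, Units.ext_iff] using h
    · simpa [Subtype.ext_iff, Units.ext_iff] using h
  have := Nat.card_le_card_of_injective f hf
  rwa [Nat.card_sum, ← two_mul] at this

/-- A bound for sums of Kloosterman sums over a coset of the kernel of a power of `θ`. -/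
theorem norm_sum_sum_kloosterman_le {R : Type*} [CommRing R] [Fintype R] [DecidableEq R]
    [IsLocalRing R] (h2 : IsUnit (2 : R))
    (Ψ : AddChar R ℂ) (J B : Ideal R) (hJ : ∀ x ∈ J, ∀ y ∈ J, x * y = 0)
    (hB : ∀ w : R, (∀ z ∈ J, Ψ (w * z) = 1) → w ∈ B) (θ : Rˣ →* ℂˣ) (β : ℂˣ) (M : ℕ)
    (T : ℂˣ → ℂ) (hT : ∀ x, ‖T (β / θ x)‖ ≤ 1) (hT0 : ∀ x, (β / θ x) ^ M ≠ 1 → T (β / θ x) = 0) :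
    ‖∑ x : Rˣ, ∑ y : Rˣ, T (β / (θ x * θ y)) * (Ψ (x : R) * Ψ (y : R))‖ ≤
      Nat.card {t : Rˣ // θ t ^ M = 1} * (2 * Nat.card B) := by
  classical
  -- Group the pairs by `t = x * y`: the weight depends on `t` alone and the inner sum is a
  -- Kloosterman sum.
  have h1 : ∑ x : Rˣ, ∑ y : Rˣ, T (β / (θ x * θ y)) * (Ψ (x : R) * Ψ (y : R)) =
      ∑ t : Rˣ, T (β / θ t) * ∑ x : Rˣ, Ψ (x : R) * Ψ ((t * x⁻¹ : Rˣ) : R) := by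
    simp_rw [Finset.mul_sum]
    rw [Finset.sum_comm (s := (Finset.univ : Finset Rˣ)) (t := (Finset.univ : Finset Rˣ))
      (f := fun t x => T (β / θ t) * (Ψ (x : R) * Ψ ((t * x⁻¹ : Rˣ) : R)))]
    refine Finset.sum_congr rfl fun x _ => ?_
    rw [← Equiv.sum_comp (Equiv.mulRight x)
      (fun t => T (β / θ t) * (Ψ (x : R) * Ψ ((t * x⁻¹ : Rˣ) : R)))]
    refine Finset.sum_congr rfl fun y _ => ?_
    rw [Equiv.coe_mulRight, mul_inv_cancel_right, map_mul, mul_comm (θ y)]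
  have hK : ∀ t : Rˣ, ‖∑ x : Rˣ, Ψ (x : R) * Ψ ((t * x⁻¹ : Rˣ) : R)‖ ≤ 2 * Nat.card B :=
    fun t => (norm_kloosterman_le_card Ψ J B hJ hB t).trans
      (by exact_mod_cast card_sq_sub_mem_le h2 B (t : R))
  -- The set on the left is empty or a coset of the kernel of `θ ^ M`; division by one of its
  -- elements maps it into the kernel.
  have hcoset : Nat.card {t : Rˣ // (β / θ t) ^ M = 1} ≤ Nat.card {t : Rˣ // θ t ^ M = 1} := by
    by_cases hne : Nonempty {t : Rˣ // (β / θ t) ^ M = 1}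
    · obtain ⟨y, hy⟩ := hne
      refine Nat.card_le_card_of_injective
        (fun t => ⟨t.1 * y⁻¹, ?_⟩ : _ → {t : Rˣ // θ t ^ M = 1}) ?_
      · have h3 := t.2
        rw [div_pow, div_eq_one] at hy h3
        rw [map_mul, map_inv, mul_pow, inv_pow, ← h3, ← hy, mul_inv_cancel]
      · intro t t' h
        simpa [Subtype.ext_iff] using h
    · rw [not_nonempty_iff] at hne
      simp
  rw [h1]
  calc _ ≤ ∑ t : Rˣ, (if (β / θ t) ^ M = 1 then (1 : ℝ) else 0) * (2 * Nat.card B) := by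
        refine norm_sum_le_of_le _ fun t _ => ?_
        rw [norm_mul]
        refine mul_le_mul ?_ (hK t) (norm_nonneg _) (by split_ifs <;> norm_num)
        split_ifs with h
        · exact hT t
        · rw [hT0 t h, norm_zero]
    _ = Nat.card {t : Rˣ // (β / θ t) ^ M = 1} * (2 * Nat.card B) := by
        rw [← Finset.sum_mul, Finset.sum_boole, ← Fintype.card_subtype, ← Nat.card_eq_fintype_card]
    _ ≤ _ := by
        refine mul_le_mul_of_nonneg_right (by exact_mod_cast hcoset) (by positivity)

/-! ### Completions, finite ideles and local components of characters. -/

namespace HeckeAverage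

open WithZero

variable {F : Type*} [Field F] [NumberField F] {v : HeightOneSpectrum (𝓞 F)}

theorem coe_adicCompletion_sub (x y : F) :
    ((x - y : F) : v.adicCompletion F) = (x : v.adicCompletion F) - y :=
  map_sub (algebraMap F (v.adicCompletion F)) x y

theorem coe_ringOfIntegers_mul (x y : 𝓞 F) :
    (((x * y : 𝓞 F) : F) : v.adicCompletion F) = ((x : F) : v.adicCompletion F) * (y : F) :=
  map_mul (algebraMap F (v.adicCompletion F)) (x : F) y

theorem coe_ringOfIntegers_sub (x y : 𝓞 F) :
    (((x - y : 𝓞 F) : F) : v.adicCompletion F) = ((x : F) : v.adicCompletion F) - (y : F) :=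
  map_sub (algebraMap F (v.adicCompletion F)) (x : F) y

theorem coe_ringOfIntegers_one : (((1 : 𝓞 F) : F) : v.adicCompletion F) = 1 :=
  map_one (algebraMap F (v.adicCompletion F))

theorem valued_coe_ringOfIntegers_le_one (v : HeightOneSpectrum (𝓞 F)) (y : 𝓞 F) :
    Valued.v ((y : F) : v.adicCompletion F) ≤ 1 := by
  rw [HeightOneSpectrum.valuedAdicCompletion_eq_valuation']
  exact v.valuation_le_one y

theorem valued_coe_ringOfIntegers_le_exp (y : 𝓞 F) (n : ℕ) :
    Valued.v ((y : F) : v.adicCompletion F) ≤ exp (-(n : ℤ)) ↔ y ∈ v.asIdeal ^ n := by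
  rw [HeightOneSpectrum.valuedAdicCompletion_eq_valuation', ← v.intValuation_le_pow_iff_mem]
  exact Iff.of_eq (congrArg (· ≤ _) (v.valuation_of_algebraMap (K := F) y))

theorem valued_coe_ringOfIntegers_eq_one (y : 𝓞 F) :
    Valued.v ((y : F) : v.adicCompletion F) = 1 ↔ y ∉ v.asIdeal := by
  rw [HeightOneSpectrum.valuedAdicCompletion_eq_valuation']
  exact v.valuation_eq_one_iff_notMem (K := F)

theorem exists_ringOfIntegers_valued_sub_le (x : v.adicCompletion F) (hx : Valued.v x ≤ 1)
    (n : ℕ) : ∃ y : 𝓞 F, Valued.v (x - ((y : F) : v.adicCompletion F)) ≤ exp (-(n : ℤ)) := by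
  have hlt : exp (-(n : ℤ)) ≤ (1 : ℤᵐ⁰) := by
    rw [← exp_zero, exp_le_exp]; omega
  obtain ⟨ϖ, hϖ⟩ := v.valuedAdicCompletion_surjective F (exp (-((n + 1 : ℕ) : ℤ)))
  have hϖ_lt : Valued.v ϖ < exp (-(n : ℤ)) := by rw [hϖ, exp_lt_exp]; omega
  -- The valuation is locally constant at `ϖ ≠ 0`, so for `z` near `x` the element `z - x + ϖ` is as
  -- small as `ϖ`, and hence so is `z - x`.
  have hopen : {z : v.adicCompletion F | Valued.v (z - x) < exp (-(n : ℤ))} ∈ nhds x := by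
    have h1 : {y : v.adicCompletion F | Valued.v y = Valued.v ϖ} ∈ nhds ϖ :=
      Valued.locally_const (by rw [hϖ]; exact exp_ne_zero)
    have h2 : Filter.Tendsto (fun z : v.adicCompletion F => z - x + ϖ) (nhds x) (nhds ϖ) := by
      have : Continuous (fun z : v.adicCompletion F => z - x + ϖ) := by fun_prop
      simpa using this.tendsto x
    filter_upwards [h2 h1] with z hz
    have h3 : z - x = (z - x + ϖ) - ϖ := by ring
    rw [h3]
    exact (Valuation.map_sub_le _ (le_of_eq hz) le_rfl).trans_lt hϖ_lt
  obtain ⟨_, hk, k, rfl⟩ := mem_closure_iff_nhds.1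
    ((HeightOneSpectrum.denseRange_algebraMap (K := F) v) x) _ hopen
  have hk' : Valued.v ((k : v.adicCompletion F) - x) < exp (-(n : ℤ)) := hk
  have hk1 : v.valuation F k ≤ 1 := by
    rw [← HeightOneSpectrum.valuedAdicCompletion_eq_valuation' v k]
    have : (k : v.adicCompletion F) = (k - x) + x := by ring
    rw [this]
    exact Valuation.map_add_le _ (hk'.le.trans hlt) hx
  obtain ⟨y, hy⟩ := v.exists_valuation_sub_lt_of_integer hk1 (Units.mk0 (exp (-(n : ℤ))) exp_ne_zero)
  refine ⟨y, ?_⟩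
  have hy' : Valued.v (((y : F) : v.adicCompletion F) - (k : v.adicCompletion F)) <
      exp (-(n : ℤ)) := by
    have := HeightOneSpectrum.valuedAdicCompletion_eq_valuation' v ((y : F) - k)
    rw [show (((y : F) - k : F) : v.adicCompletion F) = (y : F) - (k : v.adicCompletion F) from
      map_sub (algebraMap F (v.adicCompletion F)) _ _] at this
    rw [this]
    exact hy
  have : x - ((y : F) : v.adicCompletion F) = -(((y : F) : v.adicCompletion F) - k) - (k - x) := by
    ring
  rw [this]
  exact (Valuation.map_sub_le _ (by rw [Valuation.map_neg]; exact hy'.le) hk'.le)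

theorem localIdele_apply_same (v : HeightOneSpectrum (𝓞 F)) (x : (v.adicCompletion F)ˣ) :
    (localIdele v x : FiniteAdeleRing (𝓞 F) F) v = x := by
  classical
  exact RestrictedProduct.mulSingle_eq_same
    (G := fun w : HeightOneSpectrum (𝓞 F) => w.adicCompletion F)
    (S := fun w : HeightOneSpectrum (𝓞 F) => ValuationSubring (w.adicCompletion F)) _ _ _

theorem localIdele_apply_of_ne {v w : HeightOneSpectrum (𝓞 F)} (h : w ≠ v)
    (x : (v.adicCompletion F)ˣ) :
    (localIdele v x : FiniteAdeleRing (𝓞 F) F) w = 1 := by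
  classical
  exact RestrictedProduct.mulSingle_eq_of_ne
    (G := fun w : HeightOneSpectrum (𝓞 F) => w.adicCompletion F)
    (S := fun w : HeightOneSpectrum (𝓞 F) => ValuationSubring (w.adicCompletion F)) _ _ h

theorem FiniteIdele.one_apply (w : HeightOneSpectrum (𝓞 F)) :
    ((1 : FiniteIdele F) : FiniteAdeleRing (𝓞 F) F) w = 1 := rfl

theorem FiniteIdele.mul_apply (x y : FiniteIdele F) (w : HeightOneSpectrum (𝓞 F)) :
    ((x * y : FiniteIdele F) : FiniteAdeleRing (𝓞 F) F) w =
      (x : FiniteAdeleRing (𝓞 F) F) w * (y : FiniteAdeleRing (𝓞 F) F) w := rfl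

theorem FiniteIdele.inv_apply (x : FiniteIdele F) (w : HeightOneSpectrum (𝓞 F)) :
    ((x⁻¹ : FiniteIdele F) : FiniteAdeleRing (𝓞 F) F) w = ((x : FiniteAdeleRing (𝓞 F) F) w)⁻¹ :=
  eq_inv_of_mul_eq_one_left (by rw [← FiniteIdele.mul_apply, inv_mul_cancel, FiniteIdele.one_apply])

theorem FiniteIdele.pow_apply (x : FiniteIdele F) (n : ℕ) (w : HeightOneSpectrum (𝓞 F)) :
    ((x ^ n : FiniteIdele F) : FiniteAdeleRing (𝓞 F) F) w =
      ((x : FiniteAdeleRing (𝓞 F) F) w) ^ n := by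
  induction n with
  | zero => rw [pow_zero, pow_zero, FiniteIdele.one_apply]
  | succ n ih => rw [pow_succ, pow_succ, FiniteIdele.mul_apply, ih]

theorem ord_pow_self (v : HeightOneSpectrum (𝓞 F)) (n : ℕ) : ord v (v.asIdeal ^ n) = n :=
  multiplicity_pow_self v.ne_bot (by
    rw [Ideal.isUnit_iff]; exact v.isPrime.ne_top) n

theorem ord_pow_of_ne {v w : HeightOneSpectrum (𝓞 F)} (h : w ≠ v) (n : ℕ) :
    ord w (v.asIdeal ^ n) = 0 := by
  refine multiplicity_eq_zero.2 fun hdvd => h ?_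
  have h1 : v.asIdeal ≤ w.asIdeal := Ideal.dvd_iff_le.1 (w.prime.dvd_of_dvd_pow hdvd)
  exact (HeightOneSpectrum.ext (v.isMaximal.eq_of_le w.isPrime.ne_top h1)).symm

theorem uniformizerIdele_pow (ϖ : ∀ v : HeightOneSpectrum (𝓞 F), (v.adicCompletion F)ˣ)
    (v : HeightOneSpectrum (𝓞 F)) (n : ℕ) :
    uniformizerIdele ϖ (v.asIdeal ^ n) = localIdele v (ϖ v ^ n) := by
  rw [uniformizerIdele, finprod_eq_single _ v fun w hw => by rw [ord_pow_of_ne hw, pow_zero],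
    ord_pow_self, map_pow]

theorem asIdeal_dvd_pow_iff {v w : HeightOneSpectrum (𝓞 F)} {n : ℕ} (hn : n ≠ 0) :
    w.asIdeal ∣ v.asIdeal ^ n ↔ w = v := by
  refine ⟨fun hdvd => ?_, ?_⟩
  · have h1 : v.asIdeal ≤ w.asIdeal := Ideal.dvd_iff_le.1 (w.prime.dvd_of_dvd_pow hdvd)
    exact (HeightOneSpectrum.ext (v.isMaximal.eq_of_le w.isPrime.ne_top h1)).symm
  · rintro rfl
    exact dvd_pow_self _ hn

theorem ideleAt_pow (v : HeightOneSpectrum (𝓞 F)) {n : ℕ} (hn : n ≠ 0) (u : F) :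
    ideleAt (v.asIdeal ^ n) u = localIdele v (toUnit (u : v.adicCompletion F)) := by
  classical
  rw [ideleAt]
  simp_rw [asIdeal_dvd_pow_iff hn]
  rw [finprod_eq_single _ v fun w hw => by rw [finprod_eq_if, if_neg hw], finprod_eq_if, if_pos rfl]

theorem toUnit_val {x : v.adicCompletion F} (hx : x ≠ 0) : (toUnit x : v.adicCompletion F) = x := by
  rw [toUnit, dif_neg hx, Units.val_mk0]

theorem toUnit_mul {x y : v.adicCompletion F} (hx : x ≠ 0) (hy : y ≠ 0) :
    toUnit (x * y) = toUnit x * toUnit y :=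
  Units.ext (by rw [Units.val_mul, toUnit_val hx, toUnit_val hy, toUnit_val (mul_ne_zero hx hy)])

theorem mem_congruenceUnits_pow {v : HeightOneSpectrum (𝓞 F)} {n : ℕ} {x : FiniteIdele F} :
    x ∈ congruenceUnits (v.asIdeal ^ n) ↔
      (∀ w, Valued.v ((x : FiniteAdeleRing (𝓞 F) F) w) = 1) ∧
        Valued.v ((x : FiniteAdeleRing (𝓞 F) F) v - 1) ≤ exp (-(n : ℤ)) := by
  refine ⟨fun h => ⟨fun w => (h w).1, ?_⟩, fun h w => ⟨h.1 w, ?_⟩⟩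
  · have := (h v).2
    rwa [ord_pow_self] at this
  · by_cases hw : w = v
    · subst hw
      rw [ord_pow_self]
      exact h.2
    · rw [ord_pow_of_ne hw, Nat.cast_zero, neg_zero, exp_zero]
      exact Valuation.map_sub_le _ (h.1 w).le (map_one _).le

/-- The local component of a character of the ideles. -/
noncomputable def localChar (φ : Idele F →* ℂˣ) (v : HeightOneSpectrum (𝓞 F)) :
    (v.adicCompletion F)ˣ →* ℂˣ :=
  φ.comp (finiteToIdele.comp (localIdele v))

theorem localChar_apply (φ : Idele F →* ℂˣ) (v : HeightOneSpectrum (𝓞 F))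
    (x : (v.adicCompletion F)ˣ) : localChar φ v x = φ (finiteToIdele (localIdele v x)) := rfl

theorem localChar_eq_one {φ : Idele F →* ℂˣ} {n : ℕ} (hφ : v.asIdeal ^ n ∈ moduli φ)
    {x : (v.adicCompletion F)ˣ} (hx : Valued.v (x : v.adicCompletion F) = 1)
    (hx1 : Valued.v (x - 1 : v.adicCompletion F) ≤ exp (-(n : ℤ))) : localChar φ v x = 1 := by
  refine hφ.2 _ (mem_congruenceUnits_pow.2 ⟨fun w => ?_, ?_⟩)
  · by_cases hw : w = v
    · subst hw; rw [localIdele_apply_same]; exact hx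
    · rw [localIdele_apply_of_ne hw, map_one]
  · rw [localIdele_apply_same]; exact hx1

theorem localChar_eq_of_valued_sub_le {φ : Idele F →* ℂˣ} {n : ℕ} (hφ : v.asIdeal ^ n ∈ moduli φ)
    {x y : (v.adicCompletion F)ˣ} (hx : Valued.v (x : v.adicCompletion F) = 1)
    (hy : Valued.v (y : v.adicCompletion F) = 1)
    (hxy : Valued.v (x - y : v.adicCompletion F) ≤ exp (-(n : ℤ))) :
    localChar φ v x = localChar φ v y := by
  rw [← div_eq_one, ← map_div]
  have hval : ((x / y : (v.adicCompletion F)ˣ) : v.adicCompletion F) = x / y :=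
    Units.val_div_eq_div_val x y
  refine localChar_eq_one hφ ?_ ?_
  · rw [hval, map_div₀, hx, hy, div_one]
  · have : (x / y - 1 : v.adicCompletion F) = (x - y) / y := by
      rw [sub_div, div_self y.ne_zero]
    rw [hval, this, map_div₀, hy, div_one]
    exact hxy

theorem HasConductor.conductor_eq {φ : Idele F →* ℂˣ} {𝔠 : Ideal (𝓞 F)} (h : HasConductor φ 𝔠) :
    conductor φ = 𝔠 :=
  le_antisymm (sSup_le h.2) (le_sSup h.1)

/-- A character of conductor `v ^ (n + 1)` is nontrivial on the global integers congruent to `1`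
modulo `v ^ n`. -/
theorem HasConductor.exists_localChar_ne_one {φ : Idele F →* ℂˣ} {n : ℕ}
    (h : HasConductor φ (v.asIdeal ^ (n + 1))) :
    ∃ y : 𝓞 F, y ∉ v.asIdeal ∧ y - 1 ∈ v.asIdeal ^ n ∧
      localChar φ v (toUnit ((y : F) : v.adicCompletion F)) ≠ 1 := by
  by_contra! hcon
  -- If the character were trivial on these integers, `v ^ n` would be a modulus, contradicting
  -- maximality: an idele `x` congruent to `1` modulo `v ^ n` is such an integer `y` placed at `v`
  -- times an idele congruent to `1` modulo `v ^ (n + 1)`.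
  have hmod : v.asIdeal ^ n ∈ moduli φ := by
    refine ⟨pow_ne_zero _ v.ne_bot, fun x hx => ?_⟩
    rw [mem_congruenceUnits_pow] at hx
    set ξ := (x : FiniteAdeleRing (𝓞 F) F) v with hξ
    obtain ⟨y, hy⟩ := exists_ringOfIntegers_valued_sub_le ξ (hx.1 v).le (n + 1)
    have hlt : exp (-((n + 1 : ℕ) : ℤ)) < (1 : ℤᵐ⁰) := by
      rw [← exp_zero, exp_lt_exp]; omega
    have hle : exp (-((n + 1 : ℕ) : ℤ)) ≤ exp (-(n : ℤ)) := by
      rw [exp_le_exp]; omega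
    have hy1 : Valued.v ((y : F) : v.adicCompletion F) = 1 := by
      have : ((y : F) : v.adicCompletion F) = ξ - (ξ - (y : F)) := by ring
      rw [this, Valuation.map_sub_eq_of_lt_left _ (by rw [hx.1 v]; exact hy.trans_lt hlt)]
      exact hx.1 v
    have hyv := (valued_coe_ringOfIntegers_eq_one y).1 hy1
    have hyn : y - 1 ∈ v.asIdeal ^ n := by
      rw [← valued_coe_ringOfIntegers_le_exp]
      have : (((y - 1 : 𝓞 F) : F) : v.adicCompletion F) = (ξ - 1) - (ξ - (y : F)) := by
        rw [coe_ringOfIntegers_sub, coe_ringOfIntegers_one]; ring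
      rw [this]
      exact Valuation.map_sub_le _ hx.2 (hy.trans hle)
    have hy0 : ((y : F) : v.adicCompletion F) ≠ 0 := fun h0 => by
      rw [h0, map_zero] at hy1; exact zero_ne_one hy1
    have hxe : x = localIdele v (toUnit ((y : F) : v.adicCompletion F)) *
        (x * (localIdele v (toUnit ((y : F) : v.adicCompletion F)))⁻¹) := by
      rw [mul_left_comm, mul_inv_cancel, mul_one]
    rw [hxe, map_mul, map_mul, ← localChar_apply, hcon y hyv hyn, one_mul]
    refine h.1.2 _ (mem_congruenceUnits_pow.2 ⟨fun w => ?_, ?_⟩)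
    · rw [FiniteIdele.mul_apply, FiniteIdele.inv_apply, map_mul, hx.1, one_mul, map_inv₀]
      by_cases hw : w = v
      · subst hw
        rw [localIdele_apply_same, toUnit_val hy0, hy1, inv_one]
      · rw [localIdele_apply_of_ne hw, map_one, inv_one]
    · rw [FiniteIdele.mul_apply, FiniteIdele.inv_apply, localIdele_apply_same, toUnit_val hy0, ← hξ]
      have : ξ * ((y : F) : v.adicCompletion F)⁻¹ - 1 = (ξ - (y : F)) * ((y : F) : v.adicCompletion F)⁻¹ := by
        rw [sub_mul, mul_inv_cancel₀ hy0]
      rw [this, map_mul, map_inv₀, hy1, inv_one, mul_one]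
      exact hy
  have h1 := h.2 hmod
  have h2 := Ideal.pow_right_strictAnti v.asIdeal v.ne_bot v.isPrime.ne_top (Nat.lt_succ_self n)
  exact absurd h1 (not_le_of_gt h2)

theorem isUnit_quotient_mk_pow_iff {n : ℕ} (hn : n ≠ 0) (y : 𝓞 F) :
    IsUnit (Ideal.Quotient.mk (v.asIdeal ^ n) y) ↔ y ∉ v.asIdeal := by
  constructor
  · intro h hy
    obtain ⟨z, hz⟩ := h.exists_right_inv
    obtain ⟨z, rfl⟩ := Ideal.Quotient.mk_surjective z
    rw [← map_mul, ← map_one (Ideal.Quotient.mk (v.asIdeal ^ n)), Ideal.Quotient.mk_eq_mk_iff_sub_mem]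
      at hz
    have h1 := Ideal.pow_le_self hn hz
    have h2 := v.asIdeal.sub_mem (v.asIdeal.mul_mem_right z hy) h1
    rw [sub_sub_cancel] at h2
    exact v.isPrime.ne_top ((Ideal.eq_top_iff_one _).2 h2)
  · intro hy
    have h1 : IsCoprime (Ideal.span {y}) (v.asIdeal ^ n) := by
      apply IsCoprime.pow_right
      rw [Ideal.isCoprime_iff_sup_eq, sup_comm]
      exact v.isMaximal.out.2 _ (lt_of_le_of_ne le_sup_left fun h => hy (h ▸
        Ideal.mem_sup_right (Ideal.mem_span_singleton_self y)))
    rw [Ideal.isCoprime_iff_exists] at h1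
    obtain ⟨i, hi, j, hj, hij⟩ := h1
    obtain ⟨z, rfl⟩ := Ideal.mem_span_singleton'.1 hi
    refine .of_mul_eq_one_right (Ideal.Quotient.mk (v.asIdeal ^ n) z) ?_
    rw [← map_mul, ← map_one (Ideal.Quotient.mk (v.asIdeal ^ n)), Ideal.Quotient.mk_eq_mk_iff_sub_mem,
      ← hij, sub_add_cancel_left]
    exact (Ideal.neg_mem_iff _).2 hj

/-! ### Absolute values of the central character. -/

/-- Each local unit group modulo the `w`-part of `𝔑` has at most as many elements as `𝓞 F ⧸ 𝔑`, so
the factorial is an exponent for all of them at once. -/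
theorem FiniteIdele.pow_mem_congruenceUnits {𝔑 : Ideal (𝓞 F)} (h𝔑 : 𝔑 ≠ ⊥) (x : FiniteIdele F)
    (hx : ∀ w, Valued.v ((x : FiniteAdeleRing (𝓞 F) F) w) = 1) :
    x ^ (Nat.card (𝓞 F ⧸ 𝔑)).factorial ∈ congruenceUnits 𝔑 := by
  set M := (Nat.card (𝓞 F ⧸ 𝔑)).factorial
  intro w
  rw [FiniteIdele.pow_apply]
  refine ⟨by rw [map_pow, hx, one_pow], ?_⟩
  set ξ := (x : FiniteAdeleRing (𝓞 F) F) w with hξ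
  have hξ1 : Valued.v ξ = 1 := hx w
  set e := ord w 𝔑 with he
  by_cases he0 : e = 0
  · rw [he0, Nat.cast_zero, neg_zero, exp_zero]
    exact Valuation.map_sub_le _ (by rw [map_pow, hξ1, one_pow]) (map_one _).le
  obtain ⟨y, hy⟩ := exists_ringOfIntegers_valued_sub_le ξ hξ1.le e
  have hlt : exp (-(e : ℤ)) < (1 : ℤᵐ⁰) := by rw [← exp_zero, exp_lt_exp]; omega
  have hy1 : Valued.v ((y : F) : w.adicCompletion F) = 1 := by
    have : ((y : F) : w.adicCompletion F) = ξ - (ξ - (y : F)) := by ring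
    rw [this, Valuation.map_sub_eq_of_lt_left _ (by rw [hξ1]; exact hy.trans_lt hlt), hξ1]
  have hunit := (isUnit_quotient_mk_pow_iff he0 y).2 ((valued_coe_ringOfIntegers_eq_one y).1 hy1)
  obtain ⟨u, hu⟩ := hunit
  have hle : 𝔑 ≤ w.asIdeal ^ e := Ideal.dvd_iff_le.1 (pow_multiplicity_dvd _ _)
  have hfin : Finite (𝓞 F ⧸ 𝔑) := Ideal.finiteQuotientOfFreeOfNeBot 𝔑 h𝔑
  have hsurj := Ideal.Quotient.factor_surjective hle
  have hfin' : Finite (𝓞 F ⧸ w.asIdeal ^ e) := Finite.of_surjective _ hsurj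
  have hdvd : orderOf u ∣ M := by
    refine Nat.dvd_factorial (orderOf_pos u) ?_
    calc orderOf u ≤ Nat.card (𝓞 F ⧸ w.asIdeal ^ e)ˣ :=
          Nat.le_of_dvd Nat.card_pos (orderOf_dvd_natCard u)
      _ ≤ Nat.card (𝓞 F ⧸ w.asIdeal ^ e) :=
          Nat.card_le_card_of_injective _ Units.val_injective
      _ ≤ _ := Nat.card_le_card_of_surjective _ hsurj
  have hyM : y ^ M - 1 ∈ w.asIdeal ^ e := by
    rw [← Ideal.Quotient.mk_eq_mk_iff_sub_mem, map_pow, ← hu, ← Units.val_pow_eq_pow_val,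
      orderOf_dvd_iff_pow_eq_one.1 hdvd, Units.val_one, map_one]
  rw [← valued_coe_ringOfIntegers_le_exp (F := F) (v := w), coe_ringOfIntegers_sub,
    coe_ringOfIntegers_one] at hyM
  have hpow : (((y ^ M : 𝓞 F) : F) : w.adicCompletion F) = ((y : F) : w.adicCompletion F) ^ M :=
    map_pow (algebraMap F (w.adicCompletion F)) (y : F) M
  rw [hpow] at hyM
  -- `ξ - y` divides `ξ ^ M - y ^ M` with integral quotient, so the approximation survives the
  -- power.
  have hsub : Valued.v (ξ ^ M - ((y : F) : w.adicCompletion F) ^ M) ≤ exp (-(e : ℤ)) := by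
    rw [← geom_sum₂_mul, map_mul]
    refine (mul_le_mul' (Valuation.map_sum_le _ (g := 1) fun i _ => ?_) hy).trans (by rw [one_mul])
    rw [map_mul, map_pow, map_pow, hξ1, hy1, one_pow, one_pow, one_mul]
  have : ξ ^ M - 1 = (ξ ^ M - ((y : F) : w.adicCompletion F) ^ M) +
      (((y : F) : w.adicCompletion F) ^ M - 1) := by ring
  rw [this]
  exact Valuation.map_add_le _ hsub hyM

/-- The values on everywhere integral units are roots of unity, so on finite ideles the absolute
value of `χ` depends only on the valuations of the components. -/
theorem norm_eq_one_of_valued_eq_one {χ : Idele F →* ℂˣ} {𝔑 : Ideal (𝓞 F)} (h : 𝔑 ∈ moduli χ)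
    (x : FiniteIdele F) (hx : ∀ w, Valued.v ((x : FiniteAdeleRing (𝓞 F) F) w) = 1) :
    ‖(χ (finiteToIdele x) : ℂ)‖ = 1 := by
  have h1 := h.2 _ (FiniteIdele.pow_mem_congruenceUnits h.1 x hx)
  rw [map_pow, map_pow] at h1
  refine Complex.norm_eq_one_of_pow_eq_one (n := (Nat.card (𝓞 F ⧸ 𝔑)).factorial) ?_
    (Nat.factorial_ne_zero _)
  rw [← Units.val_pow_eq_pow_val, h1, Units.val_one]

theorem valued_coe_ringOfIntegers_eq_exp_ord (w : HeightOneSpectrum (𝓞 F)) {α : 𝓞 F} (hα : α ≠ 0) :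
    Valued.v ((α : F) : w.adicCompletion F) = exp (-(ord w (Ideal.span {α}) : ℤ)) := by
  rw [HeightOneSpectrum.valuedAdicCompletion_eq_valuation', ord,
    ← w.intValuation_eq_exp_neg_multiplicity hα]
  exact w.valuation_of_algebraMap (K := F) α

theorem norm_embedInfinite_algebraMap (σ : F →+* ℂ) (x : F) :
    ‖embedInfinite σ (algebraMap F (InfiniteAdeleRing F) x)‖ = ‖σ x‖ := by
  have h : ‖InfinitePlace.Completion.extensionEmbedding (InfinitePlace.mk σ)
      (algebraMap F (InfiniteAdeleRing F) x (InfinitePlace.mk σ))‖ = ‖σ x‖ := by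
    rw [InfiniteAdeleRing.algebraMap_apply, InfinitePlace.Completion.extensionEmbedding_coe,
      InfinitePlace.norm_embedding_eq]
    exact InfinitePlace.apply σ x
  rw [embedInfinite]
  split_ifs
  · exact h
  · rw [RCLike.norm_conj]; exact h

theorem prod_norm_embeddings_eq_absNorm (α : 𝓞 F) :
    ∏ σ : F →+* ℂ, ‖σ α‖ = Ideal.absNorm (Ideal.span {α}) := by
  have h1 := Algebra.norm_eq_prod_embeddings ℚ ℂ (α : F)
  rw [Ideal.absNorm_span_singleton, Nat.cast_natAbs]
  rw [← norm_prod]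
  have h2 : ∏ σ : F →+* ℂ, σ α = ∏ σ : F →ₐ[ℚ] ℂ, σ α :=
    Fintype.prod_equiv (RingHom.equivRatAlgHom F ℂ) _ _ fun _ => rfl
  rw [h2, ← h1, ← Algebra.coe_norm_int]
  simp

/-- Since `k σ + 2 * m σ` does not depend on `σ`, all embeddings carry the same exponent and their
product is a power of the norm. -/
theorem IsCentralCharacter.norm_infiniteToIdele {wt : CohomologicalWeight F} {𝔑 : Ideal (𝓞 F)}
    {χ : Idele F →* ℂˣ} (h : IsCentralCharacter wt 𝔑 χ) {α : 𝓞 F} (z : (InfiniteAdeleRing F)ˣ)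
    (hz : (z : InfiniteAdeleRing F) = algebraMap F (InfiniteAdeleRing F) (α : F)) :
    ‖(χ (infiniteToIdele z) : ℂ)‖ =
      (Ideal.absNorm (Ideal.span {α}) : ℝ) ^ (-(wt.central - 2)) := by
  rw [h.2.2, hz, norm_prod, ← prod_norm_embeddings_eq_absNorm, ← Finset.prod_zpow]
  refine Finset.prod_congr rfl fun σ _ => ?_
  rw [norm_zpow, norm_embedInfinite_algebraMap, ← wt.add_two_mul σ]
  congr 2
  ring

/-- The absolute value of a central character at a uniformizer. -/
theorem IsCentralCharacter.norm_localChar {wt : CohomologicalWeight F} {𝔑 : Ideal (𝓞 F)}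
    {χ : Idele F →* ℂˣ} (h : IsCentralCharacter wt 𝔑 χ) {ϖ : (v.adicCompletion F)ˣ}
    (hϖ : Valued.v (ϖ : v.adicCompletion F) = exp (-1 : ℤ)) :
    ‖(localChar χ v ϖ : ℂ)‖ = (Ideal.absNorm v.asIdeal : ℝ) ^ (wt.central - 2) := by
  -- With `n` the class number, `v ^ n` is generated by some `α`. As `χ` is trivial on `α`, its
  -- finite and infinite parts there are inverse to each other; the finite part has the absolute
  -- value of `χ` at `ϖ ^ n`, and an `n`-th root is taken at the end.
  set n := Nat.card (ClassGroup (𝓞 F)) with hn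
  have hn0 : n ≠ 0 := Nat.card_pos.ne'
  obtain ⟨α, hα⟩ : ∃ α : 𝓞 F, v.asIdeal ^ n = Ideal.span {α} := by
    have h1 : ClassGroup.mk0 ⟨v.asIdeal ^ n, mem_nonZeroDivisors_of_ne_zero (pow_ne_zero n v.ne_bot)⟩
        = 1 := by
      have := pow_card_eq_one' (x := ClassGroup.mk0
        ⟨v.asIdeal, mem_nonZeroDivisors_of_ne_zero v.ne_bot⟩)
      rw [← map_pow] at this
      exact this
    obtain ⟨α, hα⟩ := (ClassGroup.mk0_eq_one_iff _).1 h1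
    exact ⟨α, hα⟩
  have hα0 : α ≠ 0 := by
    rintro rfl
    exact pow_ne_zero n v.ne_bot (by rw [hα]; simp)
  have hαF : (α : F) ≠ 0 := by exact_mod_cast hα0
  set a : Fˣ := Units.mk0 (α : F) hαF
  set z : (InfiniteAdeleRing F)ˣ := Units.map (algebraMap F (InfiniteAdeleRing F)).toMonoidHom a
  set x : FiniteIdele F := Units.map (algebraMap F (FiniteAdeleRing (𝓞 F) F)).toMonoidHom a
  have hx : ∀ w, (x : FiniteAdeleRing (𝓞 F) F) w = ((α : F) : w.adicCompletion F) := fun w => rfl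
  have hprod : χ (infiniteToIdele z) * χ (finiteToIdele x) = 1 := by
    rw [← map_mul, ← h.1.2 a]
    congr 1
    exact Units.ext (Prod.ext (mul_one _) (one_mul _))
  have hunit : ‖(χ (finiteToIdele (x * (localIdele v (ϖ ^ n))⁻¹)) : ℂ)‖ = 1 := by
    refine norm_eq_one_of_valued_eq_one h.2.1 _ fun w => ?_
    rw [FiniteIdele.mul_apply, FiniteIdele.inv_apply, map_mul, hx,
      valued_coe_ringOfIntegers_eq_exp_ord w hα0, ← hα, map_inv₀]
    by_cases hw : w = v
    · subst hw
      rw [ord_pow_self, localIdele_apply_same, Units.val_pow_eq_pow_val, map_pow, hϖ, ← exp_nsmul]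
      rw [nsmul_eq_mul, mul_neg, mul_one, mul_inv_cancel₀ exp_ne_zero]
    · rw [ord_pow_of_ne hw, localIdele_apply_of_ne hw]
      simp
  have hfin : ‖(χ (finiteToIdele x) : ℂ)‖ = ‖(localChar χ v ϖ : ℂ)‖ ^ n := by
    rw [← norm_pow, ← Units.val_pow_eq_pow_val, ← map_pow, localChar_apply]
    rw [map_mul, map_mul, map_inv, map_inv, Units.val_mul, norm_mul, Units.val_inv_eq_inv_val,
      norm_inv] at hunit
    exact eq_of_mul_inv_eq_one hunit
  have hinf := h.norm_infiniteToIdele (α := α) z rfl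
  have hq : (Ideal.absNorm v.asIdeal : ℝ) ≠ 0 :=
    Nat.cast_ne_zero.2 (Ideal.absNorm_eq_zero_iff.not.2 v.ne_bot)
  rw [← hα, map_pow, Nat.cast_pow] at hinf
  have hnorm := congrArg (fun u : ℂˣ => ‖(u : ℂ)‖) hprod
  simp only [Units.val_mul, norm_mul, Units.val_one, norm_one] at hnorm
  rw [hinf, hfin, zpow_neg, ← zpow_natCast, ← zpow_mul, mul_comm (n : ℤ), zpow_mul, zpow_natCast,
    inv_mul_eq_one₀ (pow_ne_zero _ (zpow_ne_zero _ hq))] at hnorm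
  exact ((pow_left_inj₀ (zpow_nonneg (Nat.cast_nonneg _) _) (norm_nonneg _) hn0).1 hnorm).symm

end HeckeAverage

/-! ### Galois averages and the expansion of the twisted average. -/

namespace HeckeAverage

/-- The average of the conjugates over `K` of an element of `L`, as a function on `ℂ`. -/
noncomputable def galoisAverage (K : IntermediateField ℚ ℂ) (L : IntermediateField K ℂ) (z : ℂ) :
    ℂ := by
  classical
  -- Off `L` the value is `0`, so the average can serve as a weight defined on all complex numbers.
  exact (Module.finrank K L : ℂ)⁻¹ * ∑ᶠ σ : L ≃ₐ[K] L, if h : z ∈ L then (σ ⟨z, h⟩ : ℂ) else 0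

section

variable {K : IntermediateField ℚ ℂ} {L : IntermediateField K ℂ}

theorem galoisAverage_of_mem {z : ℂ} (h : z ∈ L) :
    galoisAverage K L z = (Module.finrank K L : ℂ)⁻¹ * ∑ᶠ σ : L ≃ₐ[K] L, (σ ⟨z, h⟩ : ℂ) := by
  simp [galoisAverage, h]

theorem galoisAverage_of_notMem {z : ℂ} (h : z ∉ L) : galoisAverage K L z = 0 := by
  simp [galoisAverage, h]

theorem norm_galoisAverage_le_one [FiniteDimensional K L] {z : ℂ} {M : ℕ} (hM : M ≠ 0)
    (hz : z ^ M = 1) : ‖galoisAverage K L z‖ ≤ 1 := by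
  classical
  by_cases h : z ∈ L
  · rw [galoisAverage_of_mem h, finsum_eq_sum_of_fintype, norm_mul, norm_inv, Complex.norm_natCast]
    have hpos : (0 : ℝ) < Module.finrank K L := Nat.cast_pos.2 Module.finrank_pos
    rw [inv_mul_le_one₀ hpos]
    calc _ ≤ ∑ σ : L ≃ₐ[K] L, (1 : ℝ) := by
          refine norm_sum_le_of_le _ fun σ _ => le_of_eq ?_
          refine Complex.norm_eq_one_of_pow_eq_one (n := M) ?_ hM
          have h1 : (⟨z, h⟩ : L) ^ M = 1 := Subtype.ext hz
          rw [← SubmonoidClass.coe_pow, ← map_pow, h1, map_one, OneMemClass.coe_one]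
      _ ≤ _ := by
          rw [Finset.sum_const, nsmul_one, Finset.card_univ]
          exact_mod_cast AlgEquiv.card_le
  · rw [galoisAverage_of_notMem h, norm_zero]
    exact zero_le_one

theorem galoisAverage_eq_zero [FiniteDimensional K L] [IsGalois K L] {p : ℕ} (hp : p.Prime)
    (hodd : Odd p) {m : ℕ} {z : ℂ} (hz : z ^ p ^ m = 1)
    (hmem : z ∉ IntermediateField.adjoin K {x : ℂ | x ^ p = 1}) : galoisAverage K L z = 0 := by
  by_cases h : z ∈ L
  · have h1 : (⟨z, h⟩ : L) ∉ IntermediateField.adjoin K {x : L | x ^ p = 1} := by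
      intro hcon
      apply hmem
      have h2 : z ∈ (IntermediateField.adjoin K {x : L | x ^ p = 1}).map L.val :=
        ⟨⟨z, h⟩, hcon, rfl⟩
      rw [IntermediateField.adjoin_map] at h2
      refine IntermediateField.adjoin.mono K _ _ ?_ h2
      rintro _ ⟨x, hx, rfl⟩
      exact congrArg Subtype.val hx
    have h3 := sum_galois_eq_zero_of_notMem_adjoin hp hodd (m := m) (Subtype.ext hz) h1
    rw [galoisAverage_of_mem h, finsum_eq_sum_of_fintype]
    have h4 := congrArg (Subtype.val) h3
    rw [AddSubmonoidClass.coe_finsetSum] at h4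
    rw [h4]
    simp
  · exact galoisAverage_of_notMem h

end

/-- This fixes the exponent `r` of the surviving roots of unity. If `n₀ ≥ 1` then `μ_p` lies in `K`,
so `K(μ_p) = K` and `n₀` is the bound; otherwise `n₁` is the bound by definition. -/
theorem pow_eq_one_of_mem_adjoin {K : IntermediateField ℚ ℂ} {p : ℕ} (hp : p.Prime) {n₀ n₁ : ℕ}
    (h₀ : IsGreatest {m : ℕ | ∃ ζ : ℂ, ζ ∈ K ∧ IsPrimitiveRoot ζ (p ^ m)} n₀)
    (h₁ : n₀ = 0 → IsGreatest {m : ℕ | ∃ ζ : ℂ,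
      ζ ∈ IntermediateField.adjoin K {z : ℂ | z ^ p = 1} ∧ IsPrimitiveRoot ζ (p ^ m)} n₁)
    {m : ℕ} {z : ℂ} (hz : z ^ p ^ m = 1)
    (hmem : z ∈ IntermediateField.adjoin K {x : ℂ | x ^ p = 1}) :
    z ^ p ^ (if n₀ = 0 then n₁ else n₀) = 1 := by
  obtain ⟨l, -, hl⟩ := (Nat.dvd_prime_pow hp).1 (orderOf_dvd_of_pow_eq_one hz)
  have hprim : IsPrimitiveRoot z (p ^ l) := hl ▸ IsPrimitiveRoot.orderOf z
  rw [← orderOf_dvd_iff_pow_eq_one, hl]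
  apply pow_dvd_pow
  split_ifs with h
  · exact (h₁ h).2 ⟨z, hmem, hprim⟩
  · obtain ⟨ζ, hζK, hζ⟩ := h₀.1
    obtain ⟨k, rfl⟩ := Nat.exists_eq_succ_of_ne_zero h
    have hζp : IsPrimitiveRoot (ζ ^ p ^ k) p := hζ.pow (pow_pos hp.pos _) (pow_succ p k)
    have hle : IntermediateField.adjoin K {x : ℂ | x ^ p = 1} ≤ ⊥ := by
      rw [IntermediateField.adjoin_le_iff]
      intro x hx
      have : NeZero p := ⟨hp.ne_zero⟩
      obtain ⟨i, -, rfl⟩ := hζp.eq_pow_of_pow_eq_one hx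
      exact pow_mem (pow_mem (IntermediateField.algebraMap_mem ⊥ (⟨ζ, hζK⟩ : K)) _) _
    obtain ⟨y, hy⟩ := IntermediateField.mem_bot.1 (hle hmem)
    exact h₀.2 ⟨z, hy ▸ y.2, hprim⟩

variable {F : Type*} [Field F] [NumberField F]

theorem coe_pow_eq_one {φ : Idele F →* ℂˣ} {M : ℕ} (hφ : φ ^ M = 1) (x : Idele F) :
    (φ x : ℂ) ^ M = 1 := by
  rw [← Units.val_pow_eq_pow_val, ← MonoidHom.pow_apply, hφ, MonoidHom.one_apply, Units.val_one]

/-- The values form a finite group of some order `m`, hence are all the `m`-th roots of unity. This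
makes `K(φ)` a splitting field, and thus finite and Galois over `K`. -/
theorem exists_range_eq_rootSet {φ : Idele F →* ℂˣ} {M : ℕ} (hM : M ≠ 0) (hφ : φ ^ M = 1)
    (K : IntermediateField ℚ ℂ) :
    ∃ m : ℕ, m ≠ 0 ∧ Set.range (fun x => (φ x : ℂ)) =
      (Polynomial.X ^ m - 1 : Polynomial K).rootSet ℂ := by
  classical
  have hfin : (Set.range (fun x => (φ x : ℂ))).Finite := by
    refine (Polynomial.nthRoots M (1 : ℂ)).toFinset.finite_toSet.subset ?_
    rintro _ ⟨x, rfl⟩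
    simpa [Polynomial.mem_nthRoots (Nat.pos_of_ne_zero hM)] using coe_pow_eq_one hφ x
  have hfin' : Finite φ.range := by
    refine Set.Finite.of_finite_image (f := fun u : ℂˣ => (u : ℂ)) (hfin.subset ?_)
      Units.val_injective.injOn
    rintro _ ⟨_, ⟨x, rfl⟩, rfl⟩
    exact ⟨x, rfl⟩
  set m := Nat.card φ.range with hm
  have hm0 : m ≠ 0 := Nat.card_pos.ne'
  refine ⟨m, hm0, ?_⟩
  have hne : (Polynomial.X ^ m - 1 : Polynomial K) ≠ 0 := by
    simpa using Polynomial.X_pow_sub_C_ne_zero (Nat.pos_of_ne_zero hm0) (1 : K)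
  have hsub : Set.range (fun x => (φ x : ℂ)) ⊆ (Polynomial.X ^ m - 1 : Polynomial K).rootSet ℂ := by
    rintro _ ⟨x, rfl⟩
    rw [Polynomial.mem_rootSet_of_ne hne]
    have h1 : (⟨φ x, x, rfl⟩ : φ.range) ^ m = 1 := pow_card_eq_one'
    have h2 : (φ x : ℂ) ^ m = 1 := congrArg (fun u : φ.range => ((u : ℂˣ) : ℂ)) h1
    simp [h2]
  refine Set.eq_of_subset_of_ncard_le hsub ?_ (Polynomial.rootSet_finite _ _)
  have h3 : Set.ncard (Set.range (fun x => (φ x : ℂ))) = m := by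
    have : Set.range (fun x => (φ x : ℂ)) = (fun u : ℂˣ => (u : ℂ)) '' (φ.range : Set ℂˣ) := by
      ext; simp
    rw [this, Set.ncard_image_of_injective _ Units.val_injective]
    rfl
  rw [h3]
  refine (Polynomial.ncard_rootSet_le _ _).trans ?_
  simpa using (Polynomial.natDegree_X_pow_sub_C (n := m) (r := (1 : K))).le

theorem valueField_isSplittingField {φ : Idele F →* ℂˣ} {M : ℕ} (hM : M ≠ 0) (hφ : φ ^ M = 1)
    (K : IntermediateField ℚ ℂ) : ∃ m : ℕ, m ≠ 0 ∧
      (Polynomial.X ^ m - 1 : Polynomial K).IsSplittingField K (valueField K φ) := by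
  obtain ⟨m, hm, h⟩ := exists_range_eq_rootSet hM hφ K
  refine ⟨m, hm, ?_⟩
  rw [valueField, h]
  exact IntermediateField.adjoin_rootSet_isSplittingField (IsAlgClosed.splits _)

theorem finiteDimensional_valueField {φ : Idele F →* ℂˣ} {M : ℕ} (hM : M ≠ 0) (hφ : φ ^ M = 1)
    (K : IntermediateField ℚ ℂ) : FiniteDimensional K (valueField K φ) := by
  obtain ⟨m, -, h⟩ := valueField_isSplittingField hM hφ K
  exact Polynomial.IsSplittingField.finiteDimensional _ (Polynomial.X ^ m - 1 : Polynomial K)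

theorem isGalois_valueField {φ : Idele F →* ℂˣ} {M : ℕ} (hM : M ≠ 0) (hφ : φ ^ M = 1)
    (K : IntermediateField ℚ ℂ) : IsGalois K (valueField K φ) := by
  obtain ⟨m, hm, h⟩ := valueField_isSplittingField hM hφ K
  refine IsGalois.of_separable_splitting_field (p := (Polynomial.X ^ m - 1 : Polynomial K)) ?_
  exact Polynomial.separable_X_pow_sub_C (1 : K) (Nat.cast_ne_zero.2 hm) one_ne_zero

theorem coe_mem_valueField (K : IntermediateField ℚ ℂ) (φ : Idele F →* ℂˣ) (x : Idele F) :
    (φ x : ℂ) ∈ valueField K φ :=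
  IntermediateField.subset_adjoin K _ (Set.mem_range_self x)

theorem coe_galConj (K : IntermediateField ℚ ℂ) (φ : Idele F →* ℂˣ)
    (σ : valueField K φ ≃ₐ[K] valueField K φ) (x : Idele F) :
    (galConj K φ σ x : ℂ) = (σ ⟨φ x, coe_mem_valueField K φ x⟩ : ℂ) := rfl

theorem galConj_eq_one_iff (K : IntermediateField ℚ ℂ) (φ : Idele F →* ℂˣ)
    (σ : valueField K φ ≃ₐ[K] valueField K φ) (x : Idele F) : galConj K φ σ x = 1 ↔ φ x = 1 := by
  rw [← Units.val_inj, coe_galConj, ← Units.val_inj, Units.val_one, ← OneMemClass.coe_one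
    (valueField K φ), Subtype.coe_inj]
  rw [map_eq_one_iff σ σ.injective, Subtype.ext_iff,
    OneMemClass.coe_one]

theorem galConj_pow_eq_one (K : IntermediateField ℚ ℂ) {φ : Idele F →* ℂˣ} {M : ℕ}
    (hφ : φ ^ M = 1) (σ : valueField K φ ≃ₐ[K] valueField K φ) : galConj K φ σ ^ M = 1 := by
  ext x
  rw [MonoidHom.pow_apply, ← map_pow, MonoidHom.one_apply, Units.val_inj, galConj_eq_one_iff,
    map_pow, ← MonoidHom.pow_apply, hφ, MonoidHom.one_apply]

/-- The conductor depends only on the kernel, which a character shares with its inverse and its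
Galois conjugates. -/
theorem conductor_congr {φ φ' : Idele F →* ℂˣ} (h : ∀ x, φ x = 1 ↔ φ' x = 1) :
    conductor φ = conductor φ' := by
  simp only [conductor, moduli, h]

theorem conductor_galConj (K : IntermediateField ℚ ℂ) (φ : Idele F →* ℂˣ)
    (σ : valueField K φ ≃ₐ[K] valueField K φ) : conductor (galConj K φ σ) = conductor φ :=
  conductor_congr (galConj_eq_one_iff K φ σ)

theorem conjChar_eq_inv {φ : Idele F →* ℂˣ} {M : ℕ} (hM : M ≠ 0) (hφ : φ ^ M = 1) :
    conjChar φ = φ⁻¹ := by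
  ext x
  have := Complex.norm_eq_one_of_pow_eq_one (coe_pow_eq_one hφ x) hM
  rw [MonoidHom.inv_apply, Units.val_inv_eq_inv_val, Complex.inv_eq_conj this]
  rfl

theorem conductor_inv (φ : Idele F →* ℂˣ) : conductor φ⁻¹ = conductor φ :=
  conductor_congr fun x => by rw [MonoidHom.inv_apply, inv_eq_one]

/-- The idele at which the character is taken in the term of the Gauss sum given by a class. -/
noncomputable def gaussIdele (ϖ : ∀ v : HeightOneSpectrum (𝓞 F), (v.adicCompletion F)ˣ)
    (𝔠 : Ideal (𝓞 F)) (q : F ⧸ (1 : Submodule (𝓞 F) F)) : Idele F :=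
  finiteToIdele (uniformizerIdele ϖ 𝔠 * ideleAt 𝔠 (Quotient.out q))

/-- The value of the additive character in the term of the Gauss sum given by a class. -/
noncomputable def gaussAddChar (d : FiniteIdele F) (𝔠 : Ideal (𝓞 F))
    (q : F ⧸ (1 : Submodule (𝓞 F) F)) : ℂ :=
  addChar ((0 : InfiniteAdeleRing F),
    ((d⁻¹ : FiniteIdele F) : FiniteAdeleRing (𝓞 F) F) * adeleAt 𝔠 (Quotient.out q))

theorem gaussSum_eq_sum {ι : Type*} [Fintype ι] {ϖ : ∀ v : HeightOneSpectrum (𝓞 F),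
    (v.adicCompletion F)ˣ} {d : FiniteIdele F} {φ : Idele F →* ℂˣ} {𝔠 : Ideal (𝓞 F)}
    (h𝔠 : conductor φ = 𝔠) (e : ι ≃ primitiveClasses 𝔠) :
    gaussSum ϖ d φ = (φ (finiteToIdele d) : ℂ)⁻¹ *
      ∑ i, (φ (gaussIdele ϖ 𝔠 (e i)) : ℂ) * gaussAddChar d 𝔠 (e i) := by
  rw [gaussSum, h𝔠, ← finsum_eq_sum_of_fintype]
  congr 1
  exact (finsum_set_coe_eq_finsum_mem (f := fun q =>
    (φ (gaussIdele ϖ 𝔠 q) : ℂ) * gaussAddChar d 𝔠 q) (primitiveClasses 𝔠)).symm.trans (finsum_comp_equiv e).symm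

/-- The twisted average as a double sum over classes. -/
theorem twistedAverage_eq_sum {ι : Type*} [Fintype ι] {ϖ : ∀ v : HeightOneSpectrum (𝓞 F),
    (v.adicCompletion F)ˣ} {d : FiniteIdele F} (k : ℤ) (χ : Idele F →* ℂˣ) (𝔑 : Ideal (𝓞 F))
    (K : IntermediateField ℚ ℂ) {φ : Idele F →* ℂˣ} {M : ℕ} (hM : M ≠ 0) (hφ : φ ^ M = 1)
    {𝔠 : Ideal (𝓞 F)} (h𝔠 : conductor φ = 𝔠) (e : ι ≃ primitiveClasses 𝔠) {𝔞 : Ideal (𝓞 F)}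
    (h𝔞 : 𝔞 ≠ ⊥ ∧ IsCoprime 𝔞 𝔠) :
    ∃ y : Idele F, twistedAverage ϖ d k χ 𝔑 K φ 𝔞 =
      (Ideal.absNorm 𝔠 : ℂ) ^ (1 - k) * (χ (finiteToIdele (uniformizerIdele ϖ 𝔠)) : ℂ) *
        starRingEnd ℂ (levelChar χ 𝔑 (uniformizerIdele ϖ 𝔠) : ℂ) *
      ∑ i, ∑ j, galoisAverage K (valueField K φ)
        (φ y / (φ (gaussIdele ϖ 𝔠 (e i)) * φ (gaussIdele ϖ 𝔠 (e j))) : ℂˣ) *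
        (gaussAddChar d 𝔠 (e i) * gaussAddChar d 𝔠 (e j)) := by
  have := finiteDimensional_valueField hM hφ K
  set x₁ : Idele F := finiteToIdele (-(uniformizerIdele ϖ 𝔠) ^ 2)
  set x₂ : Idele F := finiteToIdele d
  set x₃ : Idele F := finiteToIdele (uniformizerIdele ϖ 𝔞)
  set A : ℂ := (Ideal.absNorm 𝔠 : ℂ) ^ (1 - k) *
    (χ (finiteToIdele (uniformizerIdele ϖ 𝔠)) : ℂ) *
    starRingEnd ℂ (levelChar χ 𝔑 (uniformizerIdele ϖ 𝔠) : ℂ) with hA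
  -- `x₁` comes from the factor `φ(-ϖ_𝔠²)`, `x₂ ^ 2` from the square of the leading factor of the
  -- Gauss sum of `φ⁻¹`, and `x₃⁻¹` from the conjugate of `φ(𝔞)`.
  refine ⟨x₁ * x₂ ^ 2 * x₃⁻¹, ?_⟩
  have hterm : ∀ σ : valueField K φ ≃ₐ[K] valueField K φ,
      rootFactor ϖ d k χ 𝔑 (galConj K φ σ) * starRingEnd ℂ (idealValue ϖ (galConj K φ σ) 𝔞) =
      A * ∑ i, ∑ j, (galConj K φ σ (x₁ * x₂ ^ 2 * x₃⁻¹ *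
        (gaussIdele ϖ 𝔠 (e i))⁻¹ * (gaussIdele ϖ 𝔠 (e j))⁻¹) : ℂ) *
        (gaussAddChar d 𝔠 (e i) * gaussAddChar d 𝔠 (e j)) := by
    intro σ
    set φ' := galConj K φ σ with hφ'
    have hφ'M : φ' ^ M = 1 := galConj_pow_eq_one K hφ σ
    have hc : conductor φ' = 𝔠 := (conductor_galConj K φ σ).trans h𝔠
    have hconj : starRingEnd ℂ (φ' x₃ : ℂ) = (φ' x₃ : ℂ)⁻¹ :=
      (Complex.inv_eq_conj (Complex.norm_eq_one_of_pow_eq_one (coe_pow_eq_one hφ'M x₃) hM)).symm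
    rw [rootFactor, idealValue, hc, if_pos h𝔞, hconj, conjChar_eq_inv hM hφ'M,
      gaussSum_eq_sum ((conductor_inv φ').trans hc) e]
    simp only [map_mul, map_inv, map_pow, Units.val_mul, Units.val_inv_eq_inv_val,
      Units.val_pow_eq_pow_val, MonoidHom.inv_apply, inv_inv, mul_pow]
    rw [sq (∑ i, _), Finset.sum_mul_sum, hA]
    simp only [Finset.mul_sum, Finset.sum_mul]
    refine Finset.sum_congr rfl fun i _ => Finset.sum_congr rfl fun j _ => ?_
    ring
  rw [twistedAverage, finsum_congr hterm, finsum_eq_sum_of_fintype, ← Finset.mul_sum,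
    mul_left_comm]
  congr 1
  -- Moving the sum over `σ` innermost leaves the Galois average of a single value of `φ`.
  rw [Finset.sum_comm, Finset.mul_sum]
  refine Finset.sum_congr rfl fun i _ => ?_
  rw [Finset.sum_comm, Finset.mul_sum]
  refine Finset.sum_congr rfl fun j _ => ?_
  rw [← Finset.sum_mul, ← mul_assoc]
  congr 1
  have hval : φ (x₁ * x₂ ^ 2 * x₃⁻¹) / (φ (gaussIdele ϖ 𝔠 (e i)) * φ (gaussIdele ϖ 𝔠 (e j))) =
      φ (x₁ * x₂ ^ 2 * x₃⁻¹ * (gaussIdele ϖ 𝔠 (e i))⁻¹ * (gaussIdele ϖ 𝔠 (e j))⁻¹) := by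
    rw [map_mul φ _ (gaussIdele ϖ 𝔠 (e j))⁻¹, map_mul φ _ (gaussIdele ϖ 𝔠 (e i))⁻¹, map_inv φ,
      map_inv φ, div_eq_mul_inv, mul_inv]
    exact (mul_assoc _ _ _).symm
  rw [hval, galoisAverage_of_mem (coe_mem_valueField K φ _), finsum_eq_sum_of_fintype]
  rfl

theorem twistedAverage_eq_zero {ϖ : ∀ v : HeightOneSpectrum (𝓞 F),
    (v.adicCompletion F)ˣ} {d : FiniteIdele F} (k : ℤ) (χ : Idele F →* ℂˣ) (𝔑 : Ideal (𝓞 F))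
    (K : IntermediateField ℚ ℂ) {φ : Idele F →* ℂˣ} {𝔞 : Ideal (𝓞 F)}
    (h𝔞 : ¬ (𝔞 ≠ ⊥ ∧ IsCoprime 𝔞 (conductor φ))) :
    twistedAverage ϖ d k χ 𝔑 K φ 𝔞 = 0 := by
  have hterm : ∀ σ : valueField K φ ≃ₐ[K] valueField K φ,
      rootFactor ϖ d k χ 𝔑 (galConj K φ σ) * starRingEnd ℂ (idealValue ϖ (galConj K φ σ) 𝔞) = 0 := by
    intro σ
    rw [idealValue, conductor_galConj, if_neg h𝔞, map_zero, mul_zero]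
  rw [twistedAverage, finsum_congr hterm, finsum_zero, mul_zero]

end HeckeAverage

/-! ### Classes in `F / 𝓞_F` with annihilator `v ^ n`. -/

namespace HeckeAverage

open WithZero

variable {F : Type*} [Field F] [NumberField F] {v : HeightOneSpectrum (𝓞 F)}

theorem coe_int_add (x y : 𝓞 F) : ((x + y : 𝓞 F) : F) = (x : F) + y := rfl

theorem coe_int_sub (x y : 𝓞 F) : ((x - y : 𝓞 F) : F) = (x : F) - y := rfl

theorem coe_int_mul (x y : 𝓞 F) : ((x * y : 𝓞 F) : F) = (x : F) * y := rfl

theorem coe_int_zero : ((0 : 𝓞 F) : F) = 0 := rfl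

theorem valuation_coe_le_exp_iff (y : 𝓞 F) (n : ℕ) :
    v.valuation F (y : F) ≤ exp (-(n : ℤ)) ↔ y ∈ v.asIdeal ^ n := by
  rw [← valued_coe_ringOfIntegers_le_exp (F := F),
    HeightOneSpectrum.valuedAdicCompletion_eq_valuation']

theorem valuation_coe_eq_one_iff (y : 𝓞 F) : v.valuation F (y : F) = 1 ↔ y ∉ v.asIdeal := by
  rw [← valued_coe_ringOfIntegers_eq_one (F := F),
    HeightOneSpectrum.valuedAdicCompletion_eq_valuation']

theorem valuation_coe_le_one (w : HeightOneSpectrum (𝓞 F)) (y : 𝓞 F) :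
    w.valuation F (y : F) ≤ 1 := w.valuation_le_one y

theorem valuation_coe_eq_exp {y : 𝓞 F} {n : ℕ} (h : y ∈ v.asIdeal ^ n)
    (h' : y ∉ v.asIdeal ^ (n + 1)) : v.valuation F (y : F) = exp (-(n : ℤ)) := by
  refine le_antisymm ((valuation_coe_le_exp_iff y n).2 h) ?_
  rw [← valuation_coe_le_exp_iff (F := F), not_le] at h'
  have hy0 : v.valuation F (y : F) ≠ 0 := fun h0 => by rw [h0] at h'; exact not_lt_zero h'
  rw [← exp_log hy0, exp_lt_exp] at h'
  rw [← exp_log hy0, exp_le_exp]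
  push_cast at h'
  omega

theorem exists_mem_pow_notMem_pow_succ (v : HeightOneSpectrum (𝓞 F)) (n : ℕ) :
    ∃ y ∈ v.asIdeal ^ n, y ∉ v.asIdeal ^ (n + 1) :=
  SetLike.exists_of_lt
    (Ideal.pow_right_strictAnti v.asIdeal v.ne_bot v.isPrime.ne_top (Nat.lt_succ_self n))

theorem exists_mem_pow_notMem_of_ne {w : HeightOneSpectrum (𝓞 F)} (h : w ≠ v) (n : ℕ) :
    ∃ y ∈ v.asIdeal ^ n, y ∉ w.asIdeal := by
  have h1 : ¬ v.asIdeal ^ n ≤ w.asIdeal := fun hle => h <|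
    HeightOneSpectrum.ext (v.isMaximal.eq_of_le w.isPrime.ne_top
      (w.isPrime.le_of_pow_le hle)).symm
  exact SetLike.not_le_iff_exists.1 h1

/-- A generator of the inverse of `v ^ n` at `v`. -/
theorem exists_valuation_eq_exp (v : HeightOneSpectrum (𝓞 F)) (n : ℕ) :
    ∃ u : F, v.valuation F u = exp (n : ℤ) ∧
      ∀ z ∈ v.asIdeal ^ n, ∃ y : 𝓞 F, (y : F) = z * u := by
  obtain ⟨π, hπ, hπ'⟩ := exists_mem_pow_notMem_pow_succ v n
  have hπ0 : (π : F) ≠ 0 := by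
    intro h
    exact hπ' ((RingOfIntegers.coe_eq_zero_iff.1 h) ▸ zero_mem _)
  -- Write `(π) = v ^ n * I` with `I` prime to `v`. For `s ∈ I` outside `v`, the quotient `s / π`
  -- has a pole of order exactly `n` at `v`, and `v ^ n` clears all of its denominators.
  obtain ⟨I, hI⟩ := Ideal.dvd_span_singleton.2 hπ
  have hIv : ¬ I ≤ v.asIdeal := by
    intro hle
    apply hπ'
    rw [← Ideal.dvd_span_singleton, hI, pow_succ]
    exact mul_dvd_mul_left _ (Ideal.dvd_iff_le.2 hle)
  obtain ⟨s, hs, hsv⟩ := SetLike.not_le_iff_exists.1 hIv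
  refine ⟨s / π, ?_, fun z hz => ?_⟩
  · rw [map_div₀, (valuation_coe_eq_one_iff s).2 hsv, valuation_coe_eq_exp hπ hπ', one_div,
      ← exp_neg, neg_neg]
  · have h1 : z * s ∈ Ideal.span {π} := hI ▸ Ideal.mul_mem_mul hz hs
    obtain ⟨y, hy⟩ := Ideal.mem_span_singleton'.1 h1
    refine ⟨y, ?_⟩
    have h2 : (y : F) * π = z * s := by exact_mod_cast congrArg (algebraMap (𝓞 F) F) hy
    rw [mul_div_assoc', ← h2, mul_div_cancel_right₀ _ hπ0]

theorem valuation_le_one_of_forall_mul_mem {n : ℕ} {u : F}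
    (hu : ∀ z ∈ v.asIdeal ^ n, ∃ y : 𝓞 F, (y : F) = z * u) {w : HeightOneSpectrum (𝓞 F)}
    (hw : w ≠ v) : w.valuation F u ≤ 1 := by
  obtain ⟨z, hz, hzw⟩ := exists_mem_pow_notMem_of_ne hw n
  obtain ⟨y, hy⟩ := hu z hz
  have h1 := valuation_coe_le_one w y
  rwa [hy, map_mul, (valuation_coe_eq_one_iff z).2 hzw, one_mul] at h1

theorem valuation_le_exp_of_forall_mul_mem {n : ℕ} {u : F}
    (hu : ∀ z ∈ v.asIdeal ^ n, ∃ y : 𝓞 F, (y : F) = z * u) : v.valuation F u ≤ exp (n : ℤ) := by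
  obtain ⟨z, hz, hzv⟩ := exists_mem_pow_notMem_pow_succ v n
  obtain ⟨y, hy⟩ := hu z hz
  have h1 := valuation_coe_le_one v y
  rw [hy, map_mul, valuation_coe_eq_exp hz hzv] at h1
  calc v.valuation F u = exp (n : ℤ) * (exp (-(n : ℤ)) * v.valuation F u) := by
        rw [← mul_assoc, ← exp_add, add_neg_cancel, exp_zero, one_mul]
    _ ≤ exp (n : ℤ) * 1 := mul_le_mul_right h1 _
    _ = _ := mul_one _

theorem exists_ringOfIntegers_eq {u : F} (h : ∀ w : HeightOneSpectrum (𝓞 F), w.valuation F u ≤ 1) :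
    ∃ y : 𝓞 F, (y : F) = u :=
  HeightOneSpectrum.mem_integers_of_valuation_le_one F u h

theorem mk_eq_zero_iff (u : F) :
    (Submodule.Quotient.mk u : F ⧸ (1 : Submodule (𝓞 F) F)) = 0 ↔ ∃ y : 𝓞 F, (y : F) = u := by
  rw [Submodule.Quotient.mk_eq_zero, Submodule.mem_one]

theorem torsionOf_mk_smul {n : ℕ} {u : F} (hv : v.valuation F u = exp (n : ℤ))
    (hu : ∀ z ∈ v.asIdeal ^ n, ∃ y : 𝓞 F, (y : F) = z * u) {x : 𝓞 F} (hx : x ∉ v.asIdeal) :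
    Ideal.torsionOf (𝓞 F) (F ⧸ (1 : Submodule (𝓞 F) F)) (Submodule.Quotient.mk ((x : F) * u)) =
      v.asIdeal ^ n := by
  ext z
  have hsmul : z • (Submodule.Quotient.mk ((x : F) * u) : F ⧸ (1 : Submodule (𝓞 F) F)) =
      Submodule.Quotient.mk ((z : F) * ((x : F) * u)) := rfl
  rw [Ideal.mem_torsionOf_iff, hsmul, mk_eq_zero_iff]
  constructor
  · rintro ⟨y, hy⟩
    have h1 := valuation_coe_le_one v y
    rw [hy, map_mul, map_mul, (valuation_coe_eq_one_iff x).2 hx, one_mul, hv] at h1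
    rw [← valuation_coe_le_exp_iff (F := F)]
    calc v.valuation F (z : F) = v.valuation F (z : F) * exp (n : ℤ) * exp (-(n : ℤ)) := by
          rw [mul_assoc, ← exp_add, add_neg_cancel, exp_zero, mul_one]
      _ ≤ 1 * exp (-(n : ℤ)) := mul_le_mul_left h1 _
      _ = _ := one_mul _
  · intro hz
    obtain ⟨y, hy⟩ := hu z hz
    refine ⟨x * y, ?_⟩
    rw [coe_int_mul, hy]
    ring

theorem mk_out_sub_mem (v : HeightOneSpectrum (𝓞 F)) {n : ℕ} {x : 𝓞 F ⧸ v.asIdeal ^ n} {z : 𝓞 F}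
    (h : Ideal.Quotient.mk (v.asIdeal ^ n) z = x) : Quotient.out x - z ∈ v.asIdeal ^ n := by
  rw [← Ideal.Quotient.mk_eq_mk_iff_sub_mem, h]
  exact Quotient.out_eq x

theorem mk_out (v : HeightOneSpectrum (𝓞 F)) {n : ℕ} (x : 𝓞 F ⧸ v.asIdeal ^ n) :
    Ideal.Quotient.mk (v.asIdeal ^ n) (Quotient.out x) = x := Quotient.out_eq x

theorem out_notMem {n : ℕ} (hn : n ≠ 0) (x : (𝓞 F ⧸ v.asIdeal ^ n)ˣ) :
    (Quotient.out (x : 𝓞 F ⧸ v.asIdeal ^ n) : 𝓞 F) ∉ v.asIdeal := by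
  rw [← isUnit_quotient_mk_pow_iff hn, mk_out]
  exact x.isUnit

/-- The units modulo `v ^ n` parametrize the classes with annihilator `v ^ n`. -/
theorem exists_units_equiv_primitiveClasses {n : ℕ} (hn : n ≠ 0) {u : F}
    (hv : v.valuation F u = exp (n : ℤ))
    (hu : ∀ z ∈ v.asIdeal ^ n, ∃ y : 𝓞 F, (y : F) = z * u) :
    ∃ e : (𝓞 F ⧸ v.asIdeal ^ n)ˣ ≃ primitiveClasses (v.asIdeal ^ n),
      ∀ x : (𝓞 F ⧸ v.asIdeal ^ n)ˣ, (e x : F ⧸ (1 : Submodule (𝓞 F) F)) =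
        Submodule.Quotient.mk (((Quotient.out (x : 𝓞 F ⧸ v.asIdeal ^ n) : 𝓞 F) : F) * u) := by
  let f : (𝓞 F ⧸ v.asIdeal ^ n)ˣ → primitiveClasses (v.asIdeal ^ n) := fun x =>
    ⟨Submodule.Quotient.mk (((Quotient.out (x : 𝓞 F ⧸ v.asIdeal ^ n) : 𝓞 F) : F) * u),
      torsionOf_mk_smul hv hu (out_notMem hn x)⟩
  have hu0 : u ≠ 0 := by
    rintro rfl
    rw [map_zero] at hv
    exact exp_ne_zero hv.symm
  have hinj : Function.Injective f := by
    intro x x' h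
    have h1 := congrArg Subtype.val h
    simp only [f] at h1
    rw [← sub_eq_zero, ← Submodule.Quotient.mk_sub, mk_eq_zero_iff, ← sub_mul] at h1
    obtain ⟨y, hy⟩ := h1
    have h2 := valuation_coe_le_one v y
    rw [hy, map_mul, hv, ← map_sub] at h2
    have h3 : (Quotient.out (x : 𝓞 F ⧸ v.asIdeal ^ n) : 𝓞 F) -
        Quotient.out (x' : 𝓞 F ⧸ v.asIdeal ^ n) ∈ v.asIdeal ^ n := by
      rw [← valuation_coe_le_exp_iff (F := F)]
      refine (le_mul_inv_iff₀ (zero_lt_iff.2 exp_ne_zero)).2 h2 |>.trans ?_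
      rw [one_mul, exp_neg]
    rw [← Ideal.Quotient.mk_eq_mk_iff_sub_mem, mk_out, mk_out] at h3
    exact Units.ext h3
  have hsurj : Function.Surjective f := by
    rintro ⟨q, hq⟩
    obtain ⟨t, rfl⟩ := Submodule.Quotient.mk_surjective _ q
    have hmem : ∀ z : 𝓞 F, z ∈ v.asIdeal ^ n ↔ ∃ y : 𝓞 F, (y : F) = z * t := by
      intro z
      rw [← mk_eq_zero_iff, ← (show _ = v.asIdeal ^ n from hq), Ideal.mem_torsionOf_iff]
      rfl
    have ht := fun z hz => (hmem z).1 hz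
    -- For a class `t` killed by `v ^ n`, the quotient `t / u` is integral at `v`; the required
    -- residue is that of an integer `x` close to it.
    have htv : v.valuation F (t / u) ≤ 1 := by
      rw [map_div₀, hv]
      exact (div_le_one₀ (zero_lt_iff.2 exp_ne_zero)).2 (valuation_le_exp_of_forall_mul_mem ht)
    obtain ⟨x, hx⟩ := exists_ringOfIntegers_valued_sub_le (v := v) ((t / u : F) : v.adicCompletion F)
      (by rw [HeightOneSpectrum.valuedAdicCompletion_eq_valuation']; exact htv) n
    rw [← coe_adicCompletion_sub, HeightOneSpectrum.valuedAdicCompletion_eq_valuation'] at hx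
    have hclose : ∀ x' : 𝓞 F, x - x' ∈ v.asIdeal ^ n → ∃ y : 𝓞 F, (y : F) = t - x' * u := by
      intro x' hx'
      apply exists_ringOfIntegers_eq
      intro w
      by_cases hw : w = v
      · subst hw
        have h1 : t - x' * u = (t / u - x) * u + ((x - x' : 𝓞 F) : F) * u := by
          rw [coe_int_sub, sub_mul, div_mul_cancel₀ _ hu0]; ring
        have h2 : ∀ a : F, w.valuation F a ≤ exp (-(n : ℤ)) → w.valuation F (a * u) ≤ 1 := by
          intro a ha
          rw [map_mul, hv]
          refine (mul_le_mul_left ha _).trans ?_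
          rw [← exp_add, neg_add_cancel, exp_zero]
        rw [h1]
        exact Valuation.map_add_le _ (h2 _ hx) (h2 _ ((valuation_coe_le_exp_iff _ _).2 hx'))
      · refine Valuation.map_sub_le _ (valuation_le_one_of_forall_mul_mem ht hw) ?_
        rw [map_mul]
        exact mul_le_one' (valuation_coe_le_one w x') (valuation_le_one_of_forall_mul_mem hu hw)
    -- If `x` were in `v`, then `v ^ (n - 1)` would already annihilate the class of `t`.
    have hxv : x ∉ v.asIdeal := by
      intro hxv
      obtain ⟨m, rfl⟩ := Nat.exists_eq_succ_of_ne_zero hn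
      obtain ⟨z, hz, hz'⟩ := exists_mem_pow_notMem_pow_succ v m
      apply hz'
      rw [hmem]
      obtain ⟨y, hy⟩ := hclose x (by rw [sub_self]; exact zero_mem _)
      obtain ⟨y', hy'⟩ := hu (z * x) (by rw [pow_succ]; exact Ideal.mul_mem_mul hz hxv)
      refine ⟨z * y + y', ?_⟩
      rw [coe_int_add, coe_int_mul, hy, hy', coe_int_mul]
      ring
    obtain ⟨x₁, hx₁⟩ := (isUnit_quotient_mk_pow_iff hn x).2 hxv
    refine ⟨x₁, Subtype.ext ?_⟩
    simp only [f]
    rw [eq_comm, ← sub_eq_zero, ← Submodule.Quotient.mk_sub, mk_eq_zero_iff]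
    refine hclose _ ?_
    have := mk_out_sub_mem v hx₁.symm
    rw [← neg_mem_iff, neg_sub]
    exact this
  exact ⟨Equiv.ofBijective f ⟨hinj, hsurj⟩, fun x => rfl⟩

/-! ### The additive character and the trace pairing at `v`. -/

theorem trace_coe_ringOfIntegers (y : 𝓞 F) : ∃ m : ℤ, Algebra.trace ℚ F (y : F) = m := by
  have h : IsIntegral ℤ (Algebra.trace ℚ F (y : F)) := Algebra.isIntegral_trace y.isIntegral_coe
  obtain ⟨m, hm⟩ := IsIntegrallyClosed.isIntegral_iff.1 h
  exact ⟨m, hm.symm⟩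

/-- The additive character `z ↦ exp(-2πi Tr z)` of `F`. -/
noncomputable def traceChar : AddChar F ℂ where
  toFun z := Complex.exp (-(2 * Real.pi * Complex.I * ((Algebra.trace ℚ F z : ℚ) : ℂ)))
  map_zero_eq_one' := by simp
  map_add_eq_mul' x y := by
    rw [map_add, ← Complex.exp_add]
    congr 1
    push_cast
    ring

theorem traceChar_apply (z : F) : traceChar z =
    Complex.exp (-(2 * Real.pi * Complex.I * ((Algebra.trace ℚ F z : ℚ) : ℂ))) := rfl

theorem traceChar_eq_one_iff (z : F) :
    traceChar z = 1 ↔ ∃ m : ℤ, Algebra.trace ℚ F z = m := by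
  rw [traceChar_apply, Complex.exp_neg, inv_eq_one, Complex.exp_eq_one_iff]
  refine exists_congr fun m => ?_
  rw [mul_comm, mul_left_inj' Complex.two_pi_I_ne_zero]
  norm_cast

theorem traceChar_coe_ringOfIntegers (y : 𝓞 F) : traceChar (y : F) = 1 :=
  (traceChar_eq_one_iff _).2 (trace_coe_ringOfIntegers y)

/-- Two admissible `ξ` differ by an everywhere integral element of `F`, whose trace is an integer,
so the choice made in `addChar` does not matter. -/
theorem addChar_eq_traceChar (z : FiniteAdeleRing (𝓞 F) F) (ξ : F)
    (h : ∀ w : HeightOneSpectrum (𝓞 F), Valued.v (z w - (ξ : w.adicCompletion F)) ≤ 1) :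
    addChar ((0 : InfiniteAdeleRing F), z) = traceChar ξ := by
  have hex : ∃ ξ : F, ∀ w : HeightOneSpectrum (𝓞 F),
      Valued.v (((0 : InfiniteAdeleRing F), z).2 w - (ξ : w.adicCompletion F)) ≤ 1 := ⟨ξ, h⟩
  refine (dif_pos hex).trans ?_
  set ξ' := hex.choose with hξ'
  have h' := hex.choose_spec
  rw [← hξ'] at h'
  obtain ⟨y, hy⟩ := exists_ringOfIntegers_eq (u := ξ' - ξ) fun w => by
    rw [← HeightOneSpectrum.valuedAdicCompletion_eq_valuation', coe_adicCompletion_sub]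
    have : (ξ' : w.adicCompletion F) - ξ = (z w - ξ) - (z w - ξ') := by ring
    rw [this]
    exact Valuation.map_sub_le _ (h w) (h' w)
  have h1 : traceChar ξ' = traceChar ξ := by
    rw [← sub_add_cancel ξ' ξ, AddChar.map_add_eq_mul, ← hy, traceChar_coe_ringOfIntegers, one_mul]
  rw [← h1, traceChar_apply]
  congr 1
  have h0 : ∀ w : InfinitePlace F, ((0 : InfiniteAdeleRing F) w) = 0 := fun _ => rfl
  simp only [h0, map_zero, Complex.zero_re, mul_zero, Complex.ofReal_zero, Finset.sum_const_zero,
    zero_sub, mul_neg]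

/-- An additive character of `𝓞_F` trivial on `v ^ n` as a character of the quotient. -/
theorem exists_quotient_addChar {n : ℕ} {γ : F}
    (hγ : ∀ z ∈ v.asIdeal ^ n, ∃ y : 𝓞 F, (y : F) = z * γ) :
    ∃ Ψ : AddChar (𝓞 F ⧸ v.asIdeal ^ n) ℂ, ∀ z : 𝓞 F,
      Ψ (Ideal.Quotient.mk (v.asIdeal ^ n) z) = traceChar ((z : F) * γ) := by
  have hwd : ∀ z z' : 𝓞 F, z - z' ∈ v.asIdeal ^ n →
      (traceChar ((z : F) * γ) : ℂ) = traceChar ((z' : F) * γ) := by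
    intro z z' h
    obtain ⟨y, hy⟩ := hγ _ h
    have : (z : F) * γ = ((z - z' : 𝓞 F) : F) * γ + (z' : F) * γ := by rw [coe_int_sub]; ring
    rw [this, AddChar.map_add_eq_mul, ← hy, traceChar_coe_ringOfIntegers, one_mul]
  refine ⟨{ toFun := fun r => traceChar (((Quotient.out r : 𝓞 F) : F) * γ)
            map_zero_eq_one' := ?_
            map_add_eq_mul' := fun r s => ?_ }, fun z => ?_⟩
  · rw [hwd _ 0 (mk_out_sub_mem v (map_zero _)), coe_int_zero, zero_mul, AddChar.map_zero_eq_one]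
  · rw [← AddChar.map_add_eq_mul, ← add_mul, ← map_add]
    exact hwd _ _ (mk_out_sub_mem v (by rw [map_add, mk_out, mk_out]))
  · exact hwd _ _ (mk_out_sub_mem v rfl)

/-- The trace pairing on `v ^ {-n}` is perfect at a prime `v` not dividing the different. -/
theorem mem_pow_of_forall_traceChar_eq_one (hv𝔡 : ¬ differentIdeal ℤ (𝓞 F) ≤ v.asIdeal) {a b : ℕ}
    {γ : F} (hγ : v.valuation F γ = exp ((a + b : ℕ) : ℤ)) {w : 𝓞 F}
    (h : ∀ z ∈ v.asIdeal ^ a, traceChar ((w : F) * z * γ) = 1) : w ∈ v.asIdeal ^ b := by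
  obtain ⟨δ, hδ, hδv⟩ := SetLike.not_le_iff_exists.1 hv𝔡
  obtain ⟨z, hz, hz'⟩ := exists_mem_pow_notMem_pow_succ v a
  -- Applied to all multiples of `z`, the hypothesis puts `w * z * γ` in the inverse different. An
  -- element `δ` of the different that is a unit at `v` makes it integral without changing its
  -- valuation at `v`.
  have hdual : (w : F) * z * γ ∈ Submodule.traceDual ℤ ℚ (1 : Submodule (𝓞 F) F) := by
    rw [Submodule.mem_traceDual]
    intro y hy
    obtain ⟨y, rfl⟩ := Submodule.mem_one.1 hy
    have h1 := h (z * y) (Ideal.mul_mem_right _ _ hz)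
    obtain ⟨m, hm⟩ := (traceChar_eq_one_iff _).1 h1
    refine ⟨m, ?_⟩
    rw [Algebra.traceForm_apply]
    refine Eq.trans ?_ (hm.symm.trans ?_)
    · simp
    · congr 1
      change (w : F) * (z * y) * γ = w * z * γ * y
      ring
  have hδ' : (δ : F) ∈ IsLocalization.coeSubmodule F (differentIdeal ℤ (𝓞 F)) := ⟨δ, hδ, rfl⟩
  rw [coeSubmodule_differentIdeal ℤ ℚ, Submodule.mem_div_iff_forall_mul_mem] at hδ'
  obtain ⟨y, hy⟩ := Submodule.mem_one.1 (hδ' _ hdual)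
  have h1 := valuation_coe_le_one v y
  rw [show (y : F) = δ * (w * z * γ) from hy, map_mul, (valuation_coe_eq_one_iff δ).2 hδv, one_mul,
    map_mul, map_mul, valuation_coe_eq_exp hz hz', hγ, mul_assoc, ← exp_add] at h1
  rw [← valuation_coe_le_exp_iff (F := F)]
  have h2 := (le_mul_inv_iff₀ (zero_lt_iff.2 exp_ne_zero)).2 h1
  rwa [one_mul, ← exp_neg, show -(-(a : ℤ) + ((a + b : ℕ) : ℤ)) = -(b : ℤ) by push_cast; ring] at h2

/-! ### The terms of the Gauss sums as functions on `(𝓞_F / v ^ n)ˣ`. -/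

theorem valued_toUnit_coe {x : v.adicCompletion F} (hx : Valued.v x = 1) :
    Valued.v (toUnit x : v.adicCompletion F) = 1 := by
  rw [toUnit_val (by rintro rfl; rw [map_zero] at hx; exact zero_ne_one hx), hx]

theorem coe_ne_zero_of_notMem {z : 𝓞 F} (hz : z ∉ v.asIdeal) :
    ((z : F) : v.adicCompletion F) ≠ 0 := by
  intro h
  have := (valued_coe_ringOfIntegers_eq_one (v := v) z).2 hz
  rw [h, map_zero] at this
  exact zero_ne_one this

theorem localChar_toUnit_congr {φ : Idele F →* ℂˣ} {n : ℕ} (hφ : v.asIdeal ^ n ∈ moduli φ)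
    {z z' : 𝓞 F} (hz : z ∉ v.asIdeal) (hz' : z' ∉ v.asIdeal) (h : z - z' ∈ v.asIdeal ^ n) :
    localChar φ v (toUnit ((z : F) : v.adicCompletion F)) =
      localChar φ v (toUnit ((z' : F) : v.adicCompletion F)) := by
  refine localChar_eq_of_valued_sub_le hφ
    (valued_toUnit_coe ((valued_coe_ringOfIntegers_eq_one z).2 hz))
    (valued_toUnit_coe ((valued_coe_ringOfIntegers_eq_one z').2 hz')) ?_
  rw [toUnit_val (coe_ne_zero_of_notMem hz), toUnit_val (coe_ne_zero_of_notMem hz'),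
    ← coe_ringOfIntegers_sub, valued_coe_ringOfIntegers_le_exp]
  exact h

/-- The character of `(𝓞_F / v ^ n)ˣ` induced by a character of modulus `v ^ n`. -/
noncomputable def residueChar {φ : Idele F →* ℂˣ} {n : ℕ} (hn : n ≠ 0)
    (hφ : v.asIdeal ^ n ∈ moduli φ) : (𝓞 F ⧸ v.asIdeal ^ n)ˣ →* ℂˣ :=
  MonoidHom.mk' (fun x => localChar φ v (toUnit
      (((Quotient.out (x : 𝓞 F ⧸ v.asIdeal ^ n) : 𝓞 F) : F) : v.adicCompletion F))) fun x y => by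
    have hx := out_notMem hn x
    have hy := out_notMem hn y
    rw [← map_mul, ← toUnit_mul (coe_ne_zero_of_notMem hx) (coe_ne_zero_of_notMem hy),
      ← coe_ringOfIntegers_mul]
    refine localChar_toUnit_congr hφ (out_notMem hn (x * y))
      (fun h => (v.isPrime.mem_or_mem h).elim hx hy) ?_
    exact mk_out_sub_mem v (by rw [map_mul, mk_out, mk_out, Units.val_mul])

theorem residueChar_apply {φ : Idele F →* ℂˣ} {n : ℕ} (hn : n ≠ 0)
    (hφ : v.asIdeal ^ n ∈ moduli φ) (x : (𝓞 F ⧸ v.asIdeal ^ n)ˣ) {z : 𝓞 F}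
    (hz : Ideal.Quotient.mk (v.asIdeal ^ n) z = x) :
    residueChar hn hφ x = localChar φ v (toUnit ((z : F) : v.adicCompletion F)) :=
  localChar_toUnit_congr hφ (out_notMem hn x)
    (by rw [← isUnit_quotient_mk_pow_iff hn, hz]; exact x.isUnit) (mk_out_sub_mem v hz)

/-- The terms of the Gauss sums of modulus `v ^ n` in terms of `(𝓞_F / v ^ n)ˣ`. -/
theorem exists_gauss_parametrization (hv𝔡 : ¬ differentIdeal ℤ (𝓞 F) ≤ v.asIdeal) {n : ℕ}
    (hn : n ≠ 0) (ϖ : ∀ v : HeightOneSpectrum (𝓞 F), (v.adicCompletion F)ˣ) {d : FiniteIdele F}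
    (hd : Valued.v ((d : FiniteAdeleRing (𝓞 F) F) v) = 1) :
    ∃ (e : (𝓞 F ⧸ v.asIdeal ^ n)ˣ ≃ primitiveClasses (v.asIdeal ^ n))
      (Ψ : AddChar (𝓞 F ⧸ v.asIdeal ^ n) ℂ) (y : Idele F),
      (∀ x : (𝓞 F ⧸ v.asIdeal ^ n)ˣ, gaussAddChar d (v.asIdeal ^ n) (e x) = Ψ x) ∧
      (∀ a b : ℕ, a + b = n → ∀ w : 𝓞 F ⧸ v.asIdeal ^ n,
        (∀ z ∈ (v.asIdeal ^ a).map (Ideal.Quotient.mk (v.asIdeal ^ n)), Ψ (w * z) = 1) →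
          w ∈ (v.asIdeal ^ b).map (Ideal.Quotient.mk (v.asIdeal ^ n))) ∧
      ∀ (φ : Idele F →* ℂˣ) (hφ : v.asIdeal ^ n ∈ moduli φ) (x : (𝓞 F ⧸ v.asIdeal ^ n)ˣ),
        φ (gaussIdele ϖ (v.asIdeal ^ n) (e x)) = φ y * residueChar hn hφ x := by
  classical
  obtain ⟨u, huv, hu⟩ := exists_valuation_eq_exp v n
  obtain ⟨e, he⟩ := exists_units_equiv_primitiveClasses hn huv hu
  have hdinv : Valued.v ((d : FiniteAdeleRing (𝓞 F) F) v)⁻¹ = 1 := by rw [map_inv₀, hd, inv_one]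
  -- `δ` is a global integer replacing the local component of `d⁻¹` modulo `v ^ n`; the error,
  -- multiplied by `u`, is integral at `v`.
  obtain ⟨δ, hδ⟩ := exists_ringOfIntegers_valued_sub_le _ hdinv.le n
  have hlt : exp (-(n : ℤ)) < (1 : ℤᵐ⁰) := by rw [← exp_zero, exp_lt_exp]; omega
  have hδ1 : v.valuation F (δ : F) = 1 := by
    rw [← HeightOneSpectrum.valuedAdicCompletion_eq_valuation']
    have : ((δ : F) : v.adicCompletion F) = ((d : FiniteAdeleRing (𝓞 F) F) v)⁻¹ -
        (((d : FiniteAdeleRing (𝓞 F) F) v)⁻¹ - (δ : F)) := by ring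
    rw [this, Valuation.map_sub_eq_of_lt_left _ (by rw [hdinv]; exact hδ.trans_lt hlt), hdinv]
  have hγ : ∀ z ∈ v.asIdeal ^ n, ∃ y : 𝓞 F, (y : F) = z * (δ * u) := by
    intro z hz
    obtain ⟨y, hy⟩ := hu z hz
    exact ⟨δ * y, by rw [coe_int_mul, hy]; ring⟩
  obtain ⟨Ψ, hΨ⟩ := exists_quotient_addChar hγ
  have hu0 : (u : v.adicCompletion F) ≠ 0 := by
    intro h
    have h1 := HeightOneSpectrum.valuedAdicCompletion_eq_valuation' v u
    rw [h, map_zero, huv] at h1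
    exact exp_ne_zero h1.symm
  have hout : ∀ x, ∃ y : 𝓞 F, (Quotient.out (e x : F ⧸ (1 : Submodule (𝓞 F) F)) : F) =
      ((Quotient.out (x : 𝓞 F ⧸ v.asIdeal ^ n) : 𝓞 F) : F) * u + y := by
    intro x
    have h1 : (Submodule.Quotient.mk (Quotient.out (e x : F ⧸ (1 : Submodule (𝓞 F) F))) :
        F ⧸ (1 : Submodule (𝓞 F) F)) = e x := Quotient.out_eq _
    rw [he x, ← sub_eq_zero, ← Submodule.Quotient.mk_sub, mk_eq_zero_iff, ← he x] at h1
    obtain ⟨y, hy⟩ := h1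
    exact ⟨y, by rw [hy]; ring⟩
  -- The representative of a class is `x * u` up to an integer, so the part `ϖ v ^ n * u` at `v` is
  -- common to all terms and `residueChar` at `x` remains.
  refine ⟨e, Ψ, finiteToIdele (localIdele v (ϖ v ^ n * toUnit (u : v.adicCompletion F))),
    fun x => ?_, fun a b hab w hw => ?_, fun φ hφ x => ?_⟩
  · set t : 𝓞 F := Quotient.out (x : 𝓞 F ⧸ v.asIdeal ^ n) with ht
    obtain ⟨y, hy⟩ := hout x
    rw [← mk_out v (x : 𝓞 F ⧸ v.asIdeal ^ n), hΨ, gaussAddChar, ← ht]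
    refine addChar_eq_traceChar _ _ fun w => ?_
    change Valued.v (((d⁻¹ : FiniteIdele F) : FiniteAdeleRing (𝓞 F) F) w *
      (if w.asIdeal ∣ v.asIdeal ^ n then
        ((Quotient.out (e x : F ⧸ (1 : Submodule (𝓞 F) F)) : F) : w.adicCompletion F) else 0) - _)
      ≤ 1
    rw [FiniteIdele.inv_apply]
    simp only [asIdeal_dvd_pow_iff hn]
    split_ifs with hw
    · subst hw
      have h1 : ((d : FiniteAdeleRing (𝓞 F) F) w)⁻¹ *
          ((Quotient.out (e x : F ⧸ (1 : Submodule (𝓞 F) F)) : F) : w.adicCompletion F) -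
          (((t : F) * (δ * u) : F) : w.adicCompletion F) =
          ((d : FiniteAdeleRing (𝓞 F) F) w)⁻¹ * ((y : F) : w.adicCompletion F) +
          (((d : FiniteAdeleRing (𝓞 F) F) w)⁻¹ - ((δ : F) : w.adicCompletion F)) *
            (((t : F) : w.adicCompletion F) * (u : w.adicCompletion F)) := by
        rw [hy, HeightOneSpectrum.adicCompletion.coe_add, HeightOneSpectrum.adicCompletion.coe_mul,
          HeightOneSpectrum.adicCompletion.coe_mul, HeightOneSpectrum.adicCompletion.coe_mul]
        ring
      rw [h1]
      refine Valuation.map_add_le _ ?_ ?_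
      · rw [map_mul, hdinv, one_mul]
        exact valued_coe_ringOfIntegers_le_one w y
      · rw [map_mul, map_mul, HeightOneSpectrum.valuedAdicCompletion_eq_valuation' w u, huv]
        calc _ ≤ exp (-(n : ℤ)) * (1 * exp (n : ℤ)) :=
              mul_le_mul' hδ (mul_le_mul' (valued_coe_ringOfIntegers_le_one w t) le_rfl)
          _ = 1 := by rw [one_mul, ← exp_add, neg_add_cancel, exp_zero]
    · rw [mul_zero, zero_sub, Valuation.map_neg,
        HeightOneSpectrum.valuedAdicCompletion_eq_valuation', map_mul, map_mul]
      exact mul_le_one' (valuation_coe_le_one w t) (mul_le_one' (valuation_coe_le_one w δ)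
        (valuation_le_one_of_forall_mul_mem hu hw))
  · obtain ⟨w, rfl⟩ := Ideal.Quotient.mk_surjective w
    refine Ideal.mem_map_of_mem _ (mem_pow_of_forall_traceChar_eq_one hv𝔡 (a := a) (γ := δ * u)
      (by rw [map_mul, hδ1, one_mul, huv, hab]) fun z hz => ?_)
    rw [← hw _ (Ideal.mem_map_of_mem _ hz), ← map_mul (Ideal.Quotient.mk _), hΨ, coe_int_mul]
  · obtain ⟨y, hy⟩ := hout x
    have hxv := out_notMem hn x
    rw [residueChar_apply hn hφ x (mk_out v _)]
    set t : 𝓞 F := Quotient.out (x : 𝓞 F ⧸ v.asIdeal ^ n) with ht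
    have ht1 := (valued_coe_ringOfIntegers_eq_one (v := v) t).2 hxv
    set s : v.adicCompletion F :=
      ((Quotient.out (e x : F ⧸ (1 : Submodule (𝓞 F) F)) : F) : v.adicCompletion F) with hs
    have hsu : s / (u : v.adicCompletion F) - ((t : F) : v.adicCompletion F) =
        ((y : F) : v.adicCompletion F) * (u : v.adicCompletion F)⁻¹ := by
      rw [hs, hy, HeightOneSpectrum.adicCompletion.coe_add,
        HeightOneSpectrum.adicCompletion.coe_mul, add_div, mul_div_cancel_right₀ _ hu0,
        add_sub_cancel_left, div_eq_mul_inv]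
    -- As `u⁻¹` has valuation `n`, the integer ambiguity of the representative disappears modulo `v
    -- ^ n`.
    have hsuv : Valued.v (s / (u : v.adicCompletion F) - ((t : F) : v.adicCompletion F)) ≤ exp (-(n : ℤ)) := by
      rw [hsu, map_mul, map_inv₀, HeightOneSpectrum.valuedAdicCompletion_eq_valuation' v u, huv,
        ← exp_neg]
      exact (mul_le_mul' (valued_coe_ringOfIntegers_le_one v y) le_rfl).trans (one_mul _).le
    have hsu1 : Valued.v (s / (u : v.adicCompletion F)) = 1 := by
      have : s / (u : v.adicCompletion F) = (t : F) + (s / (u : v.adicCompletion F) - ((t : F) : v.adicCompletion F)) := by ring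
      rw [this, Valuation.map_add_eq_of_lt_left _ (by rw [ht1]; exact hsuv.trans_lt hlt), ht1]
    have hsu0 : s / (u : v.adicCompletion F) ≠ 0 := by
      intro h; rw [h, map_zero] at hsu1; exact zero_ne_one hsu1
    have hs_eq : toUnit s = toUnit (u : v.adicCompletion F) * toUnit (s / (u : v.adicCompletion F)) := by
      rw [← toUnit_mul hu0 hsu0, mul_div_cancel₀ _ hu0]
    have hchar : localChar φ v (toUnit (s / (u : v.adicCompletion F))) =
        localChar φ v (toUnit ((t : F) : v.adicCompletion F)) := by
      refine localChar_eq_of_valued_sub_le hφ (valued_toUnit_coe hsu1) (valued_toUnit_coe ht1) ?_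
      rw [toUnit_val hsu0, toUnit_val (coe_ne_zero_of_notMem hxv)]
      exact hsuv
    rw [gaussIdele, uniformizerIdele_pow, ideleAt_pow v hn, ← map_mul, ← hs, hs_eq, ← mul_assoc,
      map_mul, map_mul, map_mul, ← localChar_apply, ← localChar_apply, hchar]

/-! ### Orders of the values of a character of conductor `v ^ n`. -/

/-- If `v ^ 2` divided `p`, then `v` would divide the different. -/
theorem natCast_notMem_sq (hv𝔡 : ¬ differentIdeal ℤ (𝓞 F) ≤ v.asIdeal) {p : ℕ} (hp : p.Prime) :
    (p : 𝓞 F) ∉ v.asIdeal ^ 2 := by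
  intro h
  apply hv𝔡
  have hmax : (Ideal.span {(p : ℤ)}).IsMaximal :=
    PrincipalIdealRing.isMaximal_of_irreducible (Nat.prime_iff_prime_int.1 hp).irreducible
  have h1 := pow_sub_one_dvd_differentIdeal ℤ (p := Ideal.span {(p : ℤ)}) v.asIdeal 2
    (by simpa using hp.ne_zero) (by
      rw [Ideal.map_span, Set.image_singleton, Ideal.dvd_span_singleton]
      simpa using h)
  rw [show 2 - 1 = 1 from rfl, pow_one] at h1
  exact Ideal.dvd_iff_le.1 h1

/-- At an unramified odd prime, elements congruent to `1` modulo `v ^ (k + 1)` are `p ^ k`-th powers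
modulo `v ^ (k + 2)` of elements congruent to `1` modulo `v`. -/
theorem exists_pow_sub_mem {p : ℕ} (hp : p.Prime) (hodd : Odd p) (hpv : (p : 𝓞 F) ∈ v.asIdeal)
    (hpv2 : (p : 𝓞 F) ∉ v.asIdeal ^ 2) (k : ℕ) {y : 𝓞 F} (hy : y - 1 ∈ v.asIdeal ^ (k + 1)) :
    ∃ x : 𝓞 F, x ∉ v.asIdeal ∧ x ^ p ^ k - y ∈ v.asIdeal ^ (k + 2) := by
  have hval : v.valuation F ((p : 𝓞 F) : F) = exp (-((1 : ℕ) : ℤ)) :=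
    valuation_coe_eq_exp (by rwa [pow_one]) hpv2
  have hp0 : ((p : 𝓞 F) : F) ≠ 0 := by
    intro h; rw [h, map_zero] at hval; exact exp_ne_zero hval.symm
  have hvalk : v.valuation F (((p : 𝓞 F) : F) ^ (k + 1)) = exp (-((k + 1 : ℕ) : ℤ)) := by
    rw [map_pow, hval, ← exp_nsmul]
    congr 1
    simp
  have hle : v.valuation F (((y - 1 : 𝓞 F) : F) / ((p : 𝓞 F) : F) ^ (k + 1)) ≤ 1 := by
    rw [map_div₀, hvalk]
    exact (div_le_one₀ (zero_lt_iff.2 exp_ne_zero)).2 ((valuation_coe_le_exp_iff _ _).2 hy)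
  obtain ⟨x, hx⟩ := exists_ringOfIntegers_valued_sub_le (v := v)
    ((((y - 1 : 𝓞 F) : F) / ((p : 𝓞 F) : F) ^ (k + 1) : F) : v.adicCompletion F)
    (by rw [HeightOneSpectrum.valuedAdicCompletion_eq_valuation']; exact hle) 1
  rw [← coe_adicCompletion_sub, HeightOneSpectrum.valuedAdicCompletion_eq_valuation'] at hx
  have hyx : (y - 1) - (p : 𝓞 F) ^ (k + 1) * x ∈ v.asIdeal ^ (k + 2) := by
    rw [← valuation_coe_le_exp_iff (F := F)]
    have h1 : (((y - 1) - (p : 𝓞 F) ^ (k + 1) * x : 𝓞 F) : F) = ((p : 𝓞 F) : F) ^ (k + 1) *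
        (((y - 1 : 𝓞 F) : F) / ((p : 𝓞 F) : F) ^ (k + 1) - x) := by
      rw [mul_sub, mul_div_cancel₀ _ (pow_ne_zero _ hp0)]
      rfl
    rw [h1, map_mul, hvalk]
    refine (mul_le_mul' le_rfl hx).trans ?_
    rw [← exp_add, exp_le_exp]
    push_cast
    omega
  have hp3 : 3 ≤ p := by
    rcases hp.eq_two_or_odd' with rfl | _
    · exact absurd hodd (by decide)
    · have := hp.two_le
      rcases Nat.lt_or_ge 2 p with h | h
      · exact h
      · obtain rfl : p = 2 := by omega
        exact absurd hodd (by decide)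
  -- With `x` close to `(y - 1) / p ^ (k + 1)`, use `(1 + p x)^(p^k) ≡ 1 + p^(k+1) x` modulo
  -- `p^(k+2)`. Oddness of `p` enters as `p ^ 3 ∣ p ^ p`.
  obtain ⟨c, hc⟩ := ZMod.exists_one_add_mul_pow_prime_pow_eq (R := 𝓞 F) (u := (p : 𝓞 F))
    (v := (p : 𝓞 F)) hp dvd_rfl (by
      rw [← pow_two, ← pow_succ]; exact pow_dvd_pow _ hp3) x k
  refine ⟨1 + p * x, fun h => ?_, ?_⟩
  · have h1 := v.asIdeal.sub_mem h (v.asIdeal.mul_mem_right x hpv)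
    rw [add_sub_cancel_right] at h1
    exact v.isPrime.ne_top ((Ideal.eq_top_iff_one _).2 h1)
  · have h1 : (1 + (p : 𝓞 F) * x) ^ p ^ k - y =
        (p : 𝓞 F) ^ (k + 2) * c - ((y - 1) - (p : 𝓞 F) ^ (k + 1) * x) := by
      rw [hc]; ring
    rw [h1]
    exact Ideal.sub_mem _ (Ideal.mul_mem_right _ _ (Ideal.pow_mem_pow hpv _)) hyx

/-- A character of `p`-power order and conductor `v ^ n` takes values of order at least
`p ^ (n - 1)` on the units modulo `v ^ n`. -/
theorem exists_orderOf_residueChar {p : ℕ} (hp : p.Prime) (hodd : Odd p)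
    (hpv : (p : 𝓞 F) ∈ v.asIdeal) (hpv2 : (p : 𝓞 F) ∉ v.asIdeal ^ 2) {φ : Idele F →* ℂˣ} {j : ℕ}
    (hφ : φ ^ p ^ j = 1) {n : ℕ} (hn : n ≠ 0) (hc : HasConductor φ (v.asIdeal ^ n)) :
    ∃ (x : (𝓞 F ⧸ v.asIdeal ^ n)ˣ) (m : ℕ),
      orderOf (residueChar hn hc.1 x) = p ^ m ∧ n ≤ m + 1 := by
  have hpow : ∀ x : (𝓞 F ⧸ v.asIdeal ^ n)ˣ, residueChar hn hc.1 x ^ p ^ j = 1 := by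
    intro x
    rw [residueChar_apply hn hc.1 x (mk_out v _), localChar_apply, ← MonoidHom.pow_apply, hφ,
      MonoidHom.one_apply]
  have hord : ∀ x, ∃ m, orderOf (residueChar hn hc.1 x) = p ^ m := fun x => by
    obtain ⟨m, -, hm⟩ := (Nat.dvd_prime_pow hp).1 (orderOf_dvd_of_pow_eq_one (hpow x))
    exact ⟨m, hm⟩
  rcases Nat.lt_or_ge n 2 with h2 | h2
  · obtain ⟨m, hm⟩ := hord 1
    exact ⟨1, m, hm, by omega⟩
  obtain ⟨k, rfl⟩ := Nat.exists_eq_add_of_le' h2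
  obtain ⟨y, hyv, hy1, hy⟩ := HasConductor.exists_localChar_ne_one (n := k + 1) hc
  obtain ⟨x, hxv, hxy⟩ := exists_pow_sub_mem hp hodd hpv hpv2 k hy1
  obtain ⟨x₁, hx₁⟩ := (isUnit_quotient_mk_pow_iff hn x).2 hxv
  obtain ⟨m, hm⟩ := hord x₁
  refine ⟨x₁, m, hm, ?_⟩
  -- If `m ≤ k`, the value at `x₁ ^ p ^ k`, which is the value at `y`, would be `1`.
  by_contra! hlt
  apply hy
  rw [← residueChar_apply hn hc.1 (x₁ ^ p ^ k), map_pow, ← orderOf_dvd_iff_pow_eq_one, hm]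
  · exact pow_dvd_pow _ (by omega)
  · rw [Units.val_pow_eq_pow_val, hx₁, ← map_pow, eq_comm, Ideal.Quotient.mk_eq_mk_iff_sub_mem]
    exact hxy

/-! ### The ring `𝓞_F / v ^ n` and the averaged bound over it. -/

theorem card_quotient_pow (v : HeightOneSpectrum (𝓞 F)) (n : ℕ) :
    Nat.card (𝓞 F ⧸ v.asIdeal ^ n) = Ideal.absNorm v.asIdeal ^ n := by
  rw [← map_pow, Ideal.absNorm_apply, Submodule.cardQuot_apply]

theorem absNorm_pos (v : HeightOneSpectrum (𝓞 F)) : 0 < Ideal.absNorm v.asIdeal :=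
  Nat.pos_of_ne_zero (Ideal.absNorm_eq_zero_iff.not.2 v.ne_bot)

theorem finite_quotient_pow (v : HeightOneSpectrum (𝓞 F)) (n : ℕ) :
    Finite (𝓞 F ⧸ v.asIdeal ^ n) :=
  Ideal.finiteQuotientOfFreeOfNeBot _ (pow_ne_zero n v.ne_bot)

theorem card_map_pow (v : HeightOneSpectrum (𝓞 F)) (a b : ℕ) :
    Nat.card ((v.asIdeal ^ b).map (Ideal.Quotient.mk (v.asIdeal ^ (a + b)))) =
      Ideal.absNorm v.asIdeal ^ a := by
  have h1 := Submodule.card_eq_card_quotient_mul_card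
    ((v.asIdeal ^ b).map (Ideal.Quotient.mk (v.asIdeal ^ (a + b))))
  have h2 := Nat.card_congr (DoubleQuot.quotQuotEquivQuotOfLE
    (Ideal.pow_le_pow_right (I := v.asIdeal) (Nat.le_add_left b a))).toEquiv
  rw [h2, card_quotient_pow, card_quotient_pow, pow_add] at h1
  exact (Nat.eq_of_mul_eq_mul_right (pow_pos (absNorm_pos v) b) h1).symm

theorem isLocalRing_quotient_pow (v : HeightOneSpectrum (𝓞 F)) {n : ℕ} (hn : n ≠ 0) :
    IsLocalRing (𝓞 F ⧸ v.asIdeal ^ n) := by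
  have : Nontrivial (𝓞 F ⧸ v.asIdeal ^ n) := Ideal.Quotient.nontrivial_iff.2 fun h =>
    v.isPrime.ne_top (top_le_iff.1 (h ▸ Ideal.pow_le_self hn))
  refine IsLocalRing.of_isUnit_or_isUnit_one_sub_self fun a => ?_
  obtain ⟨a, rfl⟩ := Ideal.Quotient.mk_surjective a
  rw [← map_one (Ideal.Quotient.mk (v.asIdeal ^ n)), ← map_sub, isUnit_quotient_mk_pow_iff hn,
    isUnit_quotient_mk_pow_iff hn]
  by_contra! h
  have h1 := v.asIdeal.add_mem h.1 h.2
  rw [add_sub_cancel] at h1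
  exact v.isPrime.ne_top ((Ideal.eq_top_iff_one _).2 h1)

theorem isUnit_two_quotient_pow {p : ℕ} (hodd : Odd p) (hpv : (p : 𝓞 F) ∈ v.asIdeal) {n : ℕ}
    (hn : n ≠ 0) : IsUnit (2 : 𝓞 F ⧸ v.asIdeal ^ n) := by
  have h1 : IsUnit (Ideal.Quotient.mk (v.asIdeal ^ n) 2) := by
    rw [isUnit_quotient_mk_pow_iff hn]
    intro h2
    obtain ⟨k, rfl⟩ := hodd
    have h3 := v.asIdeal.sub_mem hpv (v.asIdeal.mul_mem_right (k : 𝓞 F) h2)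
    push_cast at h3
    rw [add_sub_cancel_left] at h3
    exact v.isPrime.ne_top ((Ideal.eq_top_iff_one _).2 h3)
  rwa [map_ofNat] at h1

/-- The bound for the averaged Kloosterman sums of modulus `v ^ n`. -/
theorem norm_sum_gauss_le {p : ℕ} (hp : p.Prime) (hodd : Odd p) (hpv : (p : 𝓞 F) ∈ v.asIdeal)
    (hv𝔡 : ¬ differentIdeal ℤ (𝓞 F) ≤ v.asIdeal) {n : ℕ} (hn : n ≠ 0)
    (ϖ : ∀ v : HeightOneSpectrum (𝓞 F), (v.adicCompletion F)ˣ) {d : FiniteIdele F}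
    (hd : Valued.v ((d : FiniteAdeleRing (𝓞 F) F) v) = 1) {φ : Idele F →* ℂˣ} {j : ℕ}
    (hφ : φ ^ p ^ j = 1) (hc : HasConductor φ (v.asIdeal ^ n)) {r : ℕ} {T : ℂˣ → ℂ}
    (hT : ∀ x, ‖T (φ x)‖ ≤ 1) (hT0 : ∀ x, φ x ^ p ^ r ≠ 1 → T (φ x) = 0) :
    ∃ (_ : Fintype (𝓞 F ⧸ v.asIdeal ^ n)ˣ)
      (e : (𝓞 F ⧸ v.asIdeal ^ n)ˣ ≃ primitiveClasses (v.asIdeal ^ n)),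
      ∀ y : Idele F, ‖∑ i, ∑ j, T (φ y / (φ (gaussIdele ϖ (v.asIdeal ^ n) (e i)) *
          φ (gaussIdele ϖ (v.asIdeal ^ n) (e j)))) *
        (gaussAddChar d (v.asIdeal ^ n) (e i) * gaussAddChar d (v.asIdeal ^ n) (e j))‖ * p ^ n ≤
      2 * p ^ (r + 1) * (Ideal.absNorm v.asIdeal : ℝ) ^ n *
        (Ideal.absNorm v.asIdeal : ℝ) ^ ((n + 1) / 2) := by
  classical
  obtain ⟨e, Ψ, y₀, hΨ, hperf, hθ⟩ := exists_gauss_parametrization hv𝔡 hn ϖ hd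
  have hfin := finite_quotient_pow v n
  let _ : Fintype (𝓞 F ⧸ v.asIdeal ^ n) := Fintype.ofFinite _
  have := isLocalRing_quotient_pow v hn
  refine ⟨inferInstance, e, fun y => ?_⟩
  set θ := residueChar hn hc.1 with hθdef
  -- With `a = ⌈n/2⌉` and `b = ⌊n/2⌋`, the image of `v ^ a` has square zero because `2 * a ≥ n`, and
  -- its dual under the pairing is the image of `v ^ b`, which has `q ^ a` elements.
  set a := (n + 1) / 2 with ha
  set b := n / 2 with hb
  have hab : a + b = n := by omega
  have hθ' : ∀ x, ∃ z, θ x = φ z := fun x => ⟨_, rfl⟩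
  have hsum : (∑ i, ∑ j, T (φ y / (φ (gaussIdele ϖ (v.asIdeal ^ n) (e i)) *
          φ (gaussIdele ϖ (v.asIdeal ^ n) (e j)))) *
        (gaussAddChar d (v.asIdeal ^ n) (e i) * gaussAddChar d (v.asIdeal ^ n) (e j))) =
      ∑ i : (𝓞 F ⧸ v.asIdeal ^ n)ˣ, ∑ j : (𝓞 F ⧸ v.asIdeal ^ n)ˣ,
        T (φ (y / y₀ ^ 2) / (θ i * θ j)) * (Ψ i * Ψ j) := by
    refine Finset.sum_congr rfl fun i _ => Finset.sum_congr rfl fun j _ => ?_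
    rw [hΨ, hΨ, hθ φ hc.1, hθ φ hc.1, map_div, map_pow, div_div, sq,
      mul_mul_mul_comm (φ y₀) (φ y₀)]
  have hdiv : ∀ x, ∃ z, φ (y / y₀ ^ 2) / θ x = φ z := fun x => by
    obtain ⟨z, hz⟩ := hθ' x
    exact ⟨y / y₀ ^ 2 / z, by rw [hz, map_div φ _ z]⟩
  have hmain := norm_sum_sum_kloosterman_le (isUnit_two_quotient_pow hodd hpv hn) Ψ
    ((v.asIdeal ^ a).map (Ideal.Quotient.mk (v.asIdeal ^ n)))
    ((v.asIdeal ^ b).map (Ideal.Quotient.mk (v.asIdeal ^ n))) (by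
      intro x hx y hy
      obtain ⟨x, hx', rfl⟩ := (Ideal.mem_map_iff_of_surjective _ Ideal.Quotient.mk_surjective).1 hx
      obtain ⟨y, hy', rfl⟩ := (Ideal.mem_map_iff_of_surjective _ Ideal.Quotient.mk_surjective).1 hy
      rw [← map_mul, Ideal.Quotient.eq_zero_iff_mem]
      have h1 := Ideal.mul_mem_mul hx' hy'
      rw [← pow_add] at h1
      exact Ideal.pow_le_pow_right (by omega) h1)
    (hperf a b hab) θ (φ (y / y₀ ^ 2)) (p ^ r) T
    (fun x => by obtain ⟨z, hz⟩ := hdiv x; rw [hz]; exact hT z)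
    (fun x hx => by obtain ⟨z, hz⟩ := hdiv x; rw [hz] at hx ⊢; exact hT0 z hx)
  have hB : Nat.card ((v.asIdeal ^ b).map (Ideal.Quotient.mk (v.asIdeal ^ n))) =
      Ideal.absNorm v.asIdeal ^ a := by
    have := card_map_pow v a b
    rwa [hab] at this
  obtain ⟨x, m, hxm, hnm⟩ := exists_orderOf_residueChar hp hodd hpv (natCast_notMem_sq hv𝔡 hp) hφ
    hn hc
  have hker := card_ker_pow_mul_le hp θ r hxm
  have hcard : Nat.card (𝓞 F ⧸ v.asIdeal ^ n)ˣ ≤ Ideal.absNorm v.asIdeal ^ n := by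
    rw [← card_quotient_pow]
    exact Nat.card_le_card_of_injective _ Units.val_injective
  have hkey : Nat.card {t : (𝓞 F ⧸ v.asIdeal ^ n)ˣ // θ t ^ p ^ r = 1} * p ^ n ≤
      p ^ (r + 1) * Ideal.absNorm v.asIdeal ^ n := by
    calc _ ≤ Nat.card {t : (𝓞 F ⧸ v.asIdeal ^ n)ˣ // θ t ^ p ^ r = 1} * (p ^ m * p) := by
          rw [← pow_succ]
          exact Nat.mul_le_mul_left _ (Nat.pow_le_pow_right hp.pos hnm)
      _ ≤ p ^ r * Nat.card (𝓞 F ⧸ v.asIdeal ^ n)ˣ * p := by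
          rw [← mul_assoc]; exact Nat.mul_le_mul_right _ hker
      _ ≤ p ^ r * Ideal.absNorm v.asIdeal ^ n * p := by gcongr
      _ = _ := by ring
  have hkey' : (Nat.card {t : (𝓞 F ⧸ v.asIdeal ^ n)ˣ // θ t ^ p ^ r = 1} : ℝ) * p ^ n ≤
      p ^ (r + 1) * (Ideal.absNorm v.asIdeal : ℝ) ^ n := by exact_mod_cast hkey
  rw [hsum]
  rw [hB] at hmain
  push_cast at hmain
  calc _ ≤ (Nat.card {t : (𝓞 F ⧸ v.asIdeal ^ n)ˣ // θ t ^ p ^ r = 1} : ℝ) *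
        (2 * (Ideal.absNorm v.asIdeal : ℝ) ^ a) * p ^ n := by gcongr
    _ = ((Nat.card {t : (𝓞 F ⧸ v.asIdeal ^ n)ˣ // θ t ^ p ^ r = 1} : ℝ) * p ^ n) *
        (2 * (Ideal.absNorm v.asIdeal : ℝ) ^ a) := by ring
    _ ≤ p ^ (r + 1) * (Ideal.absNorm v.asIdeal : ℝ) ^ n *
        (2 * (Ideal.absNorm v.asIdeal : ℝ) ^ a) := by gcongr
    _ = _ := by ring

/-! ### Trivial conductor, the prefactor, and the bound for the twisted average. -/

theorem primitiveClasses_top : primitiveClasses (⊤ : Ideal (𝓞 F)) = {0} := by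
  ext q
  rw [primitiveClasses, Set.mem_ofPred_eq, Set.mem_singleton_iff, Ideal.eq_top_iff_one,
    Ideal.mem_torsionOf_iff, one_smul]

theorem gaussAddChar_top (d : FiniteIdele F) (q : F ⧸ (1 : Submodule (𝓞 F) F)) :
    gaussAddChar d ⊤ q = 1 := by
  classical
  rw [gaussAddChar, addChar_eq_traceChar _ 0, AddChar.map_zero_eq_one]
  intro w
  change Valued.v (((d⁻¹ : FiniteIdele F) : FiniteAdeleRing (𝓞 F) F) w *
    (if w.asIdeal ∣ (⊤ : Ideal (𝓞 F)) then ((Quotient.out q : F) : w.adicCompletion F) else 0) -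
      ((0 : F) : w.adicCompletion F)) ≤ 1
  rw [if_neg, mul_zero, HeightOneSpectrum.adicCompletion.coe_zero, sub_zero, map_zero]
  · exact zero_le_one
  · intro h
    exact w.isPrime.ne_top (top_le_iff.1 (Ideal.dvd_iff_le.1 h))

/-- The idele is supported at `v`, which does not divide `𝔑`, so only components equal to `1` are
evaluated. -/
theorem levelChar_eq_one {𝔑 : Ideal (𝓞 F)} (h𝔑 : ¬ 𝔑 ≤ v.asIdeal) (χ : Idele F →* ℂˣ)
    (x : (v.adicCompletion F)ˣ) : levelChar χ 𝔑 (localIdele v x) = 1 := by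
  have h1 : ∀ w : HeightOneSpectrum (𝓞 F), w.asIdeal ∣ 𝔑 →
      χ (finiteToIdele (localIdele w
        (toUnit ((localIdele v x : FiniteAdeleRing (𝓞 F) F) w)))) = 1 := by
    intro w hw
    have hwv : w ≠ v := by
      rintro rfl
      exact h𝔑 (Ideal.dvd_iff_le.1 hw)
    have h2 : toUnit (1 : w.adicCompletion F) = 1 := Units.ext (toUnit_val one_ne_zero)
    rw [localIdele_apply_of_ne hwv, h2, map_one, map_one, map_one]
  rw [levelChar, finprod_congr fun w => finprod_congr fun hw => h1 w hw]
  simp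

/-- The factors `q^(n(1-k))` from the norm and `q^(n(k-2))` from `χ` multiply to `q^(-n)`: the
weight cancels. -/
theorem norm_rootFactor_prefactor {wt : CohomologicalWeight F} {𝔑 : Ideal (𝓞 F)}
    {χ : Idele F →* ℂˣ} (hχ : IsCentralCharacter wt 𝔑 χ) (h𝔑 : ¬ 𝔑 ≤ v.asIdeal)
    {ϖ : ∀ v : HeightOneSpectrum (𝓞 F), (v.adicCompletion F)ˣ} (hϖ : IsUniformizers ϖ) (n : ℕ) :
    ‖(Ideal.absNorm (v.asIdeal ^ n) : ℂ) ^ (1 - wt.central) *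
      (χ (finiteToIdele (uniformizerIdele ϖ (v.asIdeal ^ n))) : ℂ) *
      starRingEnd ℂ (levelChar χ 𝔑 (uniformizerIdele ϖ (v.asIdeal ^ n)) : ℂ)‖ =
      ((Ideal.absNorm v.asIdeal : ℝ) ^ n)⁻¹ := by
  have hq : (Ideal.absNorm v.asIdeal : ℝ) ≠ 0 := Nat.cast_ne_zero.2 (absNorm_pos v).ne'
  rw [uniformizerIdele_pow, levelChar_eq_one h𝔑, ← localChar_apply, map_pow, map_pow, norm_mul,
    norm_mul, Units.val_one, map_one, norm_one, mul_one, norm_zpow, Units.val_pow_eq_pow_val,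
    norm_pow, hχ.norm_localChar (hϖ v), Complex.norm_natCast, Nat.cast_pow, ← zpow_natCast,
    ← zpow_natCast, ← zpow_mul, ← zpow_mul, ← zpow_add₀ hq, ← zpow_neg]
  congr 1
  ring

theorem norm_twistedAverage_le {p : ℕ} (hp : p.Prime) (hodd : Odd p) (hpv : (p : 𝓞 F) ∈ v.asIdeal)
    {n₀ n₁ : ℕ} {K : IntermediateField ℚ ℂ}
    (h₀ : IsGreatest {m : ℕ | ∃ ζ : ℂ, ζ ∈ K ∧ IsPrimitiveRoot ζ (p ^ m)} n₀)
    (h₁ : n₀ = 0 → IsGreatest {m : ℕ | ∃ ζ : ℂ,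
      ζ ∈ IntermediateField.adjoin K {z : ℂ | z ^ p = 1} ∧ IsPrimitiveRoot ζ (p ^ m)} n₁)
    {wt : CohomologicalWeight F} {𝔑 : Ideal (𝓞 F)} {χ : Idele F →* ℂˣ}
    {ϖ : ∀ v : HeightOneSpectrum (𝓞 F), (v.adicCompletion F)ˣ} {d : FiniteIdele F}
    (hχ : IsCentralCharacter wt 𝔑 χ)
    (hcop : IsCoprime v.asIdeal (differentIdeal ℤ (𝓞 F) * 𝔑)) (hϖ : IsUniformizers ϖ)
    (hd : IsIdeleOf d (differentIdeal ℤ (𝓞 F))) {n : ℕ} {φ : Idele F →* ℂˣ} {j : ℕ}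
    (hφ : φ ^ p ^ j = 1) (hc : HasConductor φ (v.asIdeal ^ n)) (𝔞 : Ideal (𝓞 F)) :
    ‖twistedAverage ϖ d wt.central χ 𝔑 K φ 𝔞‖ * p ^ n ≤
      2 * p ^ ((if n₀ = 0 then n₁ else n₀) + 1) *
        (Ideal.absNorm v.asIdeal : ℝ) ^ ((n + 1) / 2) := by
  classical
  have hcond := hc.conductor_eq
  by_cases h𝔞 : 𝔞 ≠ ⊥ ∧ IsCoprime 𝔞 (v.asIdeal ^ n)
  swap
  · rw [twistedAverage_eq_zero _ _ _ _ (by rwa [hcond]), norm_zero, zero_mul]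
    positivity
  have hle : ∀ I : Ideal (𝓞 F), IsCoprime v.asIdeal I → ¬ I ≤ v.asIdeal := fun I hI h =>
    v.isPrime.ne_top (top_le_iff.1 ((Ideal.isCoprime_iff_sup_eq.1 hI) ▸ sup_le le_rfl h))
  have hv𝔡 := hle _ hcop.of_mul_right_left
  have h𝔑 := hle _ hcop.of_mul_right_right
  have hdv : Valued.v ((d : FiniteAdeleRing (𝓞 F) F) v) = 1 := by
    rw [hd v, ord, multiplicity_eq_zero.2 fun h => hv𝔡 (Ideal.dvd_iff_le.1 h), Nat.cast_zero,
      neg_zero, exp_zero]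
  have hM : p ^ j ≠ 0 := pow_ne_zero _ hp.ne_zero
  have := finiteDimensional_valueField hM hφ K
  have := isGalois_valueField hM hφ K
  set T : ℂˣ → ℂ := fun z => galoisAverage K (valueField K φ) z with hTdef
  have hT : ∀ x, ‖T (φ x)‖ ≤ 1 := fun x => norm_galoisAverage_le_one hM (coe_pow_eq_one hφ x)
  have hT0 : ∀ x, φ x ^ p ^ (if n₀ = 0 then n₁ else n₀) ≠ 1 → T (φ x) = 0 := by
    intro x hx
    refine galoisAverage_eq_zero hp hodd (coe_pow_eq_one hφ x) fun hmem => hx (Units.ext ?_)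
    exact pow_eq_one_of_mem_adjoin hp h₀ h₁ (coe_pow_eq_one hφ x) hmem
  have hq : (0 : ℝ) < Ideal.absNorm v.asIdeal := Nat.cast_pos.2 (absNorm_pos v)
  -- `residueChar` needs a nonzero exponent. For conductor `1` the only class is `0`, and the
  -- average reduces to one Galois average.
  by_cases hn : n = 0
  · subst hn
    rw [pow_zero, Ideal.one_eq_top] at hcond
    let e : Unit ≃ primitiveClasses (⊤ : Ideal (𝓞 F)) :=
      (Equiv.ofUnique _ _).trans (Equiv.setCongr primitiveClasses_top.symm)
    obtain ⟨y, hy⟩ := twistedAverage_eq_sum (ϖ := ϖ) (d := d) wt.central χ 𝔑 K hM hφ hcond e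
      (by rwa [pow_zero, Ideal.one_eq_top] at h𝔞)
    have hA := norm_rootFactor_prefactor hχ h𝔑 hϖ 0
    rw [pow_zero, pow_zero, Ideal.one_eq_top, inv_one] at hA
    rw [hy, norm_mul, hA, one_mul, Finset.univ_unique, Finset.sum_singleton, Finset.sum_singleton,
      gaussAddChar_top, mul_one, mul_one, pow_zero, mul_one, ← map_mul, ← map_div]
    refine (hT _).trans ?_
    have hp1 : (1 : ℝ) ≤ p := by exact_mod_cast hp.one_lt.le
    have h1 : (1 : ℝ) ≤ (p : ℝ) ^ ((if n₀ = 0 then n₁ else n₀) + 1) := one_le_pow₀ hp1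
    norm_num
    linarith
  · obtain ⟨_, e, he⟩ := norm_sum_gauss_le hp hodd hpv hv𝔡 hn ϖ hdv hφ hc hT hT0
    obtain ⟨y, hy⟩ := twistedAverage_eq_sum (ϖ := ϖ) (d := d) wt.central χ 𝔑 K hM hφ hcond e h𝔞
    rw [hy, norm_mul, norm_rootFactor_prefactor hχ h𝔑 hϖ n, mul_assoc]
    refine (mul_le_mul_of_nonneg_left (he y) (by positivity)).trans (le_of_eq ?_)
    field_simp

end HeckeAverage

/-! ### The estimate as a power of the norm of `𝔭`. -/

theorem mainTheorem4 {F : Type*} [Field F] [NumberField F]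
    (p : ℕ) (hp : p.Prime) (hodd : Odd p)
    (hdiscr : ¬ (p : ℤ) ∣ NumberField.discr F)
    (hclass : p.Coprime (NumberField.classNumber F))
    (𝔭 : HeightOneSpectrum (𝓞 F)) (h𝔭 : (p : 𝓞 F) ∈ 𝔭.asIdeal)
    (n₀ n₁ : ℕ) :
    ∃ C : ℝ, ∀ (K : IntermediateField ℚ ℂ), FiniteDimensional ℚ K →
      IsGreatest {m : ℕ | ∃ ζ : ℂ, ζ ∈ K ∧ IsPrimitiveRoot ζ (p ^ m)} n₀ →
      (n₀ = 0 → IsGreatest {m : ℕ | ∃ ζ : ℂ,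
        ζ ∈ IntermediateField.adjoin K {z : ℂ | z ^ p = 1} ∧ IsPrimitiveRoot ζ (p ^ m)} n₁) →
      ∀ (wt : HeckeAverage.CohomologicalWeight F) (𝔑 : Ideal (𝓞 F))
        (χ : HeckeAverage.Idele F →* ℂˣ)
        (ϖ : ∀ v : HeightOneSpectrum (𝓞 F), (v.adicCompletion F)ˣ)
        (d : HeckeAverage.FiniteIdele F),
      HeckeAverage.IsCentralCharacter wt 𝔑 χ →
      IsCoprime 𝔭.asIdeal (differentIdeal ℤ (𝓞 F) * 𝔑) →
      HeckeAverage.IsUniformizers ϖ →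
      HeckeAverage.IsIdeleOf d (differentIdeal ℤ (𝓞 F)) →
      ∀ (n : ℕ) (ψ : HeckeAverage.Idele F →* ℂˣ),
      HeckeAverage.IsHeckeCharacter ψ →
      (∃ j : ℕ, orderOf ψ = p ^ j) →
      HeckeAverage.HasConductor ψ (𝔭.asIdeal ^ (n + n₀)) →
      ∀ 𝔞 : Ideal (𝓞 F),
        ‖HeckeAverage.twistedAverage ϖ d wt.central χ 𝔑 K ψ 𝔞‖ ≤
          C * (Ideal.absNorm 𝔭.asIdeal : ℝ) ^
            ((n : ℝ) * (1 / 2 - 1 / (𝔭.asIdeal.inertiaDeg ℤ : ℝ))) := by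
  set q : ℝ := (Ideal.absNorm 𝔭.asIdeal : ℝ) with hq
  set f : ℝ := (𝔭.asIdeal.inertiaDeg ℤ : ℝ) with hf
  have hpp := Nat.prime_iff_prime_int.1 hp
  have hlies : 𝔭.asIdeal.LiesOver (Ideal.span {(p : ℤ)}) := by
    refine ⟨?_⟩
    have hmax : (Ideal.span {(p : ℤ)}).IsMaximal :=
      PrincipalIdealRing.isMaximal_of_irreducible hpp.irreducible
    refine hmax.eq_of_le (Ideal.IsPrime.under ℤ 𝔭.asIdeal).ne_top ?_
    rw [Ideal.span_singleton_le_iff_mem, Ideal.mem_under]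
    simpa using h𝔭
  have hqp : q = (p : ℝ) ^ 𝔭.asIdeal.inertiaDeg ℤ := by
    rw [hq, ← Ideal.pow_inertiaDeg p 𝔭.asIdeal, Nat.cast_pow]
  have hf0 : f ≠ 0 := Nat.cast_ne_zero.2 (Ideal.inertiaDeg_pos 𝔭.asIdeal ℤ).ne'
  have hp0 : (0 : ℝ) < p := Nat.cast_pos.2 hp.pos
  have hq0 : 0 < q := by rw [hqp]; positivity
  have hq1 : 1 ≤ q := by rw [hqp]; exact one_le_pow₀ (by exact_mod_cast hp.one_lt.le)
  have hpq : ∀ N : ℕ, (p : ℝ) ^ N = q ^ ((N : ℝ) / f) := by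
    intro N
    rw [hqp, ← Real.rpow_natCast, ← Real.rpow_natCast, ← Real.rpow_mul hp0.le]
    congr 1
    rw [← hf]
    field_simp
  -- `q ^ (1 / 2)` absorbs the rounding in `⌈(n + n₀)/2⌉`, and the last factor is the contribution
  -- of the shift by `n₀` in the conductor. `n₁` enters only when `n₀ = 0`.
  refine ⟨2 * p ^ ((if n₀ = 0 then n₁ else n₀) + 1) * q ^ ((1 : ℝ) / 2) *
    q ^ ((n₀ : ℝ) * (1 / 2 - 1 / f)), ?_⟩
  intro K _ h₀ h₁ wt 𝔑 χ ϖ d hχ hcop hϖ hd n ψ _ hψ hc 𝔞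
  obtain ⟨j, hj⟩ := hψ
  have hbound := HeckeAverage.norm_twistedAverage_le hp hodd h𝔭 h₀ h₁ hχ hcop hϖ hd
    (orderOf_dvd_iff_pow_eq_one.1 hj.dvd) hc 𝔞
  rw [← le_div_iff₀ (by positivity)] at hbound
  refine hbound.trans ?_
  rw [← hq, hpq (n + n₀), mul_assoc (2 * (p : ℝ) ^ _), mul_assoc (2 * (p : ℝ) ^ _), mul_div_assoc]
  refine mul_le_mul_of_nonneg_left ?_ (by positivity)
  rw [← Real.rpow_natCast, ← Real.rpow_sub hq0, ← Real.rpow_add hq0, ← Real.rpow_add hq0]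
  refine Real.rpow_le_rpow_of_exponent_le hq1 ?_
  have h2 : (((n + n₀ + 1) / 2 : ℕ) : ℝ) ≤ ((n + n₀ + 1 : ℕ) : ℝ) / 2 := Nat.cast_div_le
  push_cast at h2 ⊢
  have h3 : 1 / 2 + (n₀ : ℝ) * (1 / 2 - 1 / f) + n * (1 / 2 - 1 / f) =
      (n + n₀ + 1) / 2 - (n + n₀) / f := by ring
  linarith
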